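/- Let $\Omega\subset\mathbb R^n$ be a strictly convex bounded domain with smooth boundary (strictly convex: $\Omega$ is convex and $\partial\Omega$ contains no line segment) and let $p\ge 2$ be real. Let $a^{ij}:\mathbb R^n\to\mathbb R$ $(1\le i,j\le n)$ be smooth with $a^{ij}(q)\xi_i\xi_j\ge c_0|\xi|^2$ for all $q,\xi\in\mathbb R^n$ and some constant $c_0>0$. Let $\rho:\mathbb R\to\mathbb R$ be smooth, strictly positive on $\mathbb R\setminus\{0\}$, with $$\rho''-\frac{(\rho')^2}{2\rho}=0\quad\text{on }\mathbb R\setminus\{0\},$$ and let $b_1,b_2,b_3:(0,\infty)\to\mathbb R$ be smooth and convex. Let $w$ be a positive smooth solution of $$w_t=\rho(w)\,a^{ij}(\nabla w)\,w_{ij}+b_1(w)|\nabla w|^p+b_2(w)|\nabla w|^2+b_3(w)\quad\text{in }\Omega\times(0,\infty),$$ where subscripts $i,j$ denote derivatives in $x_i,x_j$ and repeated indices are summed. Assume that $w(\cdot,t)\in C^2(\overline\Omega)$ for every $t\ge0$ and that the spatial Hessian $D^2w$ is continuous on $\overline\Omega\times[0,\infty)$ (in particular, this holds if $w$ is smooth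 on $\overline\Omega\times[0,\infty)$). For a unit vector $e$ write $w_{ee}=D^2w(e,e)$. If $$\inf_{\partial\Omega\times[0,\infty)}\ \inf_{|e|=1}w_{ee}(x,t)>0\qquad\text{and}\qquad \inf_{x\in\Omega}\ \inf_{|e|=1}w_{ee}(x,0)>0,$$ then $$\inf_{\Omega\times[0,\infty)}\ \inf_{|e|=1}w_{ee}(x,t)\ge 0;$$ in particular $x\mapsto w(x,t)$ is convex on $\Omega$ for every $t\ge 0$. -/

import Mathlib

open scoped ContDiff

/-- `Ω` has smooth boundary: near every boundary point, `Ω` is the sublevel set `{φ < 0}` of a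
smooth function `φ` whose differential does not vanish at that point. -/
def HasSmoothBoundary {n : ℕ} (Ω : Set (EuclideanSpace ℝ (Fin n))) : Prop :=
  ∀ x ∈ frontier Ω, ∃ (U : Set (EuclideanSpace ℝ (Fin n))) (φ : EuclideanSpace ℝ (Fin n) → ℝ),
    IsOpen U ∧ x ∈ U ∧ ContDiffOn ℝ ∞ φ U ∧ fderiv ℝ φ x ≠ 0 ∧ Ω ∩ U = {y ∈ U | φ y < 0}

/-- A strictly convex bounded domain with smooth boundary. Strict convexity means that the
boundary contains no segment; as `Ω` is open, this is strict convexity of its closure. -/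
structure IsStrictlyConvexSmoothDomain {n : ℕ} (Ω : Set (EuclideanSpace ℝ (Fin n))) : Prop where
  isOpen : IsOpen Ω
  nonempty : Ω.Nonempty
  isBounded : Bornology.IsBounded Ω
  convex : Convex ℝ Ω
  strictConvex_closure : StrictConvex ℝ (closure Ω)
  smoothBoundary : HasSmoothBoundary Ω

/-- The spatial Hessian `D²w(x,t)(u,v)`, for `x` in the closure of `Ω`. At points of the open set
`Ω` it is the ordinary second derivative; at boundary points it is the derivative from inside. -/
noncomputable def spaceHess {n : ℕ} (Ω : Set (EuclideanSpace ℝ (Fin n)))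
    (w : EuclideanSpace ℝ (Fin n) → ℝ → ℝ) (x : EuclideanSpace ℝ (Fin n)) (t : ℝ)
    (u v : EuclideanSpace ℝ (Fin n)) : ℝ :=
  iteratedFDerivWithin ℝ 2 (fun y => w y t) (closure Ω) x ![u, v]

/-- The spatial gradient `∇w(x,t)`. -/
noncomputable def spaceGrad {n : ℕ} (w : EuclideanSpace ℝ (Fin n) → ℝ → ℝ)
    (x : EuclideanSpace ℝ (Fin n)) (t : ℝ) : EuclideanSpace ℝ (Fin n) :=
  gradient (fun y => w y t) x

/-- `w` is smooth in `Ω × (0,∞)`, each `w(·,t)`, `t ≥ 0`, is `C²` up to the boundary of `Ω`, and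
the spatial Hessian is continuous on the closed cylinder `closure Ω × [0,∞)`. -/
structure IsSmoothOnCylinder {n : ℕ} (Ω : Set (EuclideanSpace ℝ (Fin n)))
    (w : EuclideanSpace ℝ (Fin n) → ℝ → ℝ) : Prop where
  smooth : ContDiffOn ℝ ∞ (fun z : EuclideanSpace ℝ (Fin n) × ℝ => w z.1 z.2) (Ω ×ˢ Set.Ioi 0)
  contDiffOn_slice : ∀ t : ℝ, 0 ≤ t → ContDiffOn ℝ 2 (fun y => w y t) (closure Ω)
  continuousOn_hess : ∀ u v : EuclideanSpace ℝ (Fin n),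
    ContinuousOn (fun z : EuclideanSpace ℝ (Fin n) × ℝ => spaceHess Ω w z.1 z.2 u v)
      (closure Ω ×ˢ Set.Ici 0)

/-- `w` solves `w_t = ρ(w) a^{ij}(∇w) w_{ij} + b₁(w)|∇w|^p + b₂(w)|∇w|² + b₃(w)` in
`Ω × (0,∞)`. -/
def SolvesEquation {n : ℕ} (Ω : Set (EuclideanSpace ℝ (Fin n))) (p : ℝ)
    (a : EuclideanSpace ℝ (Fin n) → Matrix (Fin n) (Fin n) ℝ) (ρ b₁ b₂ b₃ : ℝ → ℝ)
    (w : EuclideanSpace ℝ (Fin n) → ℝ → ℝ) : Prop :=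
  ∀ x ∈ Ω, ∀ t : ℝ, 0 < t →
    deriv (fun s => w x s) t =
      ρ (w x t) * (∑ i, ∑ j, a (spaceGrad w x t) i j *
        spaceHess Ω w x t (EuclideanSpace.single i 1) (EuclideanSpace.single j 1))
      + b₁ (w x t) * ‖spaceGrad w x t‖ ^ p
      + b₂ (w x t) * ‖spaceGrad w x t‖ ^ 2
      + b₃ (w x t)

/-! A maximum principle for the least eigenvalue of `D²w`. Fix a final time `T` and add `ε exp(K t)`
times the identity to `D²w`. If the sum is not positive definite up to `T`, it first degenerates at
some `(x, t)` in a unit direction `e`; put `μ = ε exp(K t)`. The lateral and initial bounds force `x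
∈ Ω` and `t > 0`. There `e` lies in the kernel of `D²w + μ` and `∇w_ee = 0`, so along `e` the
gradient `∇w` has first derivative `-μ e` and second derivative `0`.

Differentiate the equation twice along `e`. Derivatives of `a(∇w)` and `|∇w|^p`, and the factor
`w_ee`, only produce terms of order `μ`; the terms `b_i'' w_e²` are nonnegative by convexity. What
remains is `ρ a^{ij} (w_{ijee} + 2 (ρ'/ρ) w_e w_{ije} + (ρ''/ρ) w_e² w_{ij})`. Minimality along `x +
s v`, tested on the moving direction `e + s c v`, gives `w_{eevv} + 4c w_{evv} + 2c² (w_{vv} +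
μ|v|²) ≥ 0` (`spaceDeriv_conditions_of_touching`). For `c = ρ' w_e / (2ρ)` the coefficients agree
exactly because of the ODE for `ρ`. Tracing against `a` yields `w_eet ≥ μ R`
(`dirDeriv_time_ge_of_touching`).

Touching points lie in the set where `D²w(e,e) ≤ 0`, which up to time `T` is compact inside the open
cylinder; so `R` is bounded independently of `ε`. At a first touching `w_eet + K μ ≤ 0`, which is
impossible once `K > sup |R|`. Finally `ε` is taken small. -/

open Filter Topology

/-- `f` has value `a`, first derivative `b` and second derivative `c` at `0`. -/
def HasTwoJet {F : Type*} [NormedAddCommGroup F] [NormedSpace ℝ F] (f : ℝ → F) (a b c : F) : Prop :=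
  f 0 = a ∧ ∃ f' : ℝ → F, f' 0 = b ∧ (∀ᶠ s in 𝓝 0, HasDerivAt f (f' s) s) ∧ HasDerivAt f' c 0

/-! ### Second order jets of curves -/

namespace HasTwoJet

variable {F : Type*} [NormedAddCommGroup F] [NormedSpace ℝ F]

theorem congr_of_eventuallyEq {f g : ℝ → F} {a b c : F} (hf : HasTwoJet f a b c)
    (h : g =ᶠ[𝓝 0] f) : HasTwoJet g a b c := by
  obtain ⟨h0, f', h1, h2, h3⟩ := hf
  refine ⟨h.eq_of_nhds.trans h0, f', h1, ?_, h3⟩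
  filter_upwards [h2, h.eventually_nhds] with s hs hs'
  exact hs.congr_of_eventuallyEq hs'

theorem congr_val {f : ℝ → F} {a b c a' b' c' : F} (hf : HasTwoJet f a b c)
    (ha : a = a') (hb : b = b') (hc : c = c') : HasTwoJet f a' b' c' := by
  subst ha hb hc; exact hf

/-- Lets the coefficients of the two sides of the equation be compared along a line. -/
theorem unique {f g : ℝ → F} {a b c a' b' c' : F} (hf : HasTwoJet f a b c)
    (hg : HasTwoJet g a' b' c') (h : f =ᶠ[𝓝 0] g) : a = a' ∧ b = b' ∧ c = c' := by
  obtain ⟨h0, f', h1, h2, h3⟩ := hf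
  obtain ⟨k0, g', k1, k2, k3⟩ := hg.congr_of_eventuallyEq h
  have e : f' =ᶠ[𝓝 0] g' := by
    filter_upwards [h2, k2] with s hs ks
    exact hs.unique ks
  exact ⟨h0.symm.trans k0, by rw [← h1, ← k1, e.eq_of_nhds],
    (h3.congr_of_eventuallyEq e.symm).unique k3⟩

theorem const (a : F) : HasTwoJet (fun _ => a) a 0 0 :=
  ⟨rfl, fun _ => 0, rfl, .of_forall fun s => hasDerivAt_const s a, hasDerivAt_const 0 0⟩

theorem add {f g : ℝ → F} {a b c a' b' c' : F} (hf : HasTwoJet f a b c)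
    (hg : HasTwoJet g a' b' c') :
    HasTwoJet (fun s => f s + g s) (a + a') (b + b') (c + c') := by
  obtain ⟨rfl, f', rfl, h2, h3⟩ := hf
  obtain ⟨rfl, g', rfl, k2, k3⟩ := hg
  refine ⟨rfl, fun s => f' s + g' s, rfl, ?_, h3.add k3⟩
  filter_upwards [h2, k2] with s hs ks
  exact hs.add ks

theorem sum {ι : Type*} (t : Finset ι) {f : ι → ℝ → F} {a b c : ι → F}
    (hf : ∀ i, HasTwoJet (f i) (a i) (b i) (c i)) :
    HasTwoJet (fun s => ∑ i ∈ t, f i s) (∑ i ∈ t, a i) (∑ i ∈ t, b i) (∑ i ∈ t, c i) := by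
  classical
  induction t using Finset.induction_on with
  | empty => simpa using const (0 : F)
  | insert i t hi ih => simpa only [Finset.sum_insert hi] using (hf i).add ih

theorem mul {f g : ℝ → ℝ} {a b c a' b' c' : ℝ} (hf : HasTwoJet f a b c)
    (hg : HasTwoJet g a' b' c') :
    HasTwoJet (fun s => f s * g s) (a * a') (b * a' + a * b') (c * a' + 2 * (b * b') + a * c') := by
  obtain ⟨rfl, f', rfl, h2, h3⟩ := hf
  obtain ⟨rfl, g', rfl, k2, k3⟩ := hg
  refine ⟨rfl, fun s => f' s * g s + f s * g' s, rfl, ?_, ?_⟩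
  · filter_upwards [h2, k2] with s hs ks
    exact hs.mul ks
  · refine ((h3.mul k2.self_of_nhds).add (h2.self_of_nhds.mul k3)).congr_deriv ?_
    ring

/-- The chain rule for second derivatives. -/
theorem comp {G : F → ℝ} {U : Set F} (hU : IsOpen U) (hG : ContDiffOn ℝ 2 G U) {f : ℝ → F}
    {a b c : F} (ha : a ∈ U) (hf : HasTwoJet f a b c) :
    HasTwoJet (fun s => G (f s)) (G a) (fderiv ℝ G a b)
      (fderiv ℝ (fderiv ℝ G) a b b + fderiv ℝ G a c) := by
  obtain ⟨rfl, f', rfl, h2, h3⟩ := hf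
  have hd : HasDerivAt f (f' 0) 0 := h2.self_of_nhds
  have hev : ∀ᶠ s in 𝓝 0, f s ∈ U := hd.continuousAt.eventually (hU.mem_nhds ha)
  refine ⟨rfl, fun s => fderiv ℝ G (f s) (f' s), rfl, ?_, ?_⟩
  · filter_upwards [h2, hev] with s hs hsU
    exact (((hG.contDiffAt (hU.mem_nhds hsU)).differentiableAt (by norm_num)).hasFDerivAt).comp_hasDerivAt
      s hs
  · have h1 : ContDiffAt ℝ 1 (fderiv ℝ G) (f 0) :=
      (hG.contDiffAt (hU.mem_nhds ha)).fderiv_right (by norm_num)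
    have h4 : HasDerivAt (fun s => fderiv ℝ G (f s)) (fderiv ℝ (fderiv ℝ G) (f 0) (f' 0)) 0 :=
      (h1.differentiableAt (by norm_num)).hasFDerivAt.comp_hasDerivAt 0 hd
    exact h4.clm_apply h3

theorem comp_real {φ : ℝ → ℝ} {U : Set ℝ} (hU : IsOpen U) (hφ : ContDiffOn ℝ 2 φ U) {f : ℝ → ℝ}
    {a b c : ℝ} (ha : a ∈ U) (hf : HasTwoJet f a b c) :
    HasTwoJet (fun s => φ (f s)) (φ a) (deriv φ a * b)
      (deriv (deriv φ) a * b ^ 2 + deriv φ a * c) := by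
  obtain ⟨rfl, f', rfl, h2, h3⟩ := hf
  have hd : HasDerivAt f (f' 0) 0 := h2.self_of_nhds
  have hev : ∀ᶠ s in 𝓝 0, f s ∈ U := hd.continuousAt.eventually (hU.mem_nhds ha)
  refine ⟨rfl, fun s => deriv φ (f s) * f' s, rfl, ?_, ?_⟩
  · filter_upwards [h2, hev] with s hs hsU
    exact (((hφ.contDiffAt (hU.mem_nhds hsU)).differentiableAt (by norm_num)).hasDerivAt).comp s hs
  · have h1 : DifferentiableAt ℝ (deriv φ) (f 0) := by
      have : ContDiffOn ℝ 1 (deriv φ) U := hφ.deriv_of_isOpen hU (by norm_num)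
      exact (this.contDiffAt (hU.mem_nhds ha)).differentiableAt (by norm_num)
    have h4 : HasDerivAt (fun s => deriv φ (f s)) (deriv (deriv φ) (f 0) * f' 0) 0 :=
      h1.hasDerivAt.comp 0 hd
    refine (h4.mul h3).congr_deriv ?_
    ring

/-- If `c < 0`, the second derivative test makes `0` a local maximum as well, so `f` is locally
constant and `c = 0`, a contradiction. -/
theorem eq_zero_and_nonneg_of_isLocalMin {f : ℝ → ℝ} {a b c : ℝ} (hf : HasTwoJet f a b c)
    (hmin : IsLocalMin f 0) : b = 0 ∧ 0 ≤ c := by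
  have hf' := hf
  obtain ⟨h0, f', h1, h2, h3⟩ := hf
  have hb : b = 0 := by
    rw [← h1]; exact hmin.hasDerivAt_eq_zero h2.self_of_nhds
  refine ⟨hb, ?_⟩
  by_contra! hc
  have hder : deriv f =ᶠ[𝓝 0] f' := h2.mono fun s hs => hs.deriv
  have hmax : IsLocalMax f 0 := by
    refine isLocalMax_of_deriv_deriv_neg ?_ ?_ h2.self_of_nhds.continuousAt
    · rw [hder.deriv_eq, h3.deriv]; exact hc
    · rw [hder.eq_of_nhds, h1, hb]
  have hcst : f =ᶠ[𝓝 0] fun _ => f 0 := by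
    filter_upwards [hmin, hmax] with s hs hs'
    exact le_antisymm hs' hs
  have := (hf'.unique (HasTwoJet.const (f 0)) hcst).2.2
  linarith

end HasTwoJet

/-! ### Iterated directional derivatives -/

section Directional

variable {V F : Type*} [NormedAddCommGroup V] [NormedSpace ℝ V] [NormedAddCommGroup F]
  [NormedSpace ℝ F]

/-- The derivative of `f` in the direction `v`. -/
noncomputable def dirDeriv (v : V) (f : V → F) : V → F := fun z => fderiv ℝ f z v

variable {f : V → F} {U : Set V}

theorem ContDiffOn.fderiv_of_isOpen_infty (hf : ContDiffOn ℝ ∞ f U) (hU : IsOpen U) :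
    ContDiffOn ℝ ∞ (fderiv ℝ f) U :=
  hf.fderiv_of_isOpen hU (by simp)

theorem ContDiffOn.dirDeriv (hf : ContDiffOn ℝ ∞ f U) (hU : IsOpen U) (v : V) :
    ContDiffOn ℝ ∞ (dirDeriv v f) U :=
  (hf.fderiv_of_isOpen_infty hU).clm_apply contDiffOn_const

theorem ContDiffOn.hasFDerivAt_of_isOpen (hf : ContDiffOn ℝ ∞ f U) (hU : IsOpen U) {z : V}
    (hz : z ∈ U) : HasFDerivAt f (fderiv ℝ f z) z :=
  ((hf.contDiffAt (hU.mem_nhds hz)).differentiableAt (by simp)).hasFDerivAt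

theorem ContDiffOn.dirDeriv_dirDeriv (hf : ContDiffOn ℝ ∞ f U) (hU : IsOpen U) {z : V}
    (hz : z ∈ U) (u v : V) :
    _root_.dirDeriv u (_root_.dirDeriv v f) z = fderiv ℝ (fderiv ℝ f) z u v := by
  have h := (hf.fderiv_of_isOpen_infty hU).hasFDerivAt_of_isOpen hU hz
  have := h.clm_apply (hasFDerivAt_const v z)
  unfold _root_.dirDeriv
  rw [this.fderiv]
  simp

theorem ContDiffOn.dirDeriv_comm (hf : ContDiffOn ℝ ∞ f U) (hU : IsOpen U) {z : V}
    (hz : z ∈ U) (u v : V) :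
    _root_.dirDeriv u (_root_.dirDeriv v f) z = _root_.dirDeriv v (_root_.dirDeriv u f) z := by
  rw [hf.dirDeriv_dirDeriv hU hz, hf.dirDeriv_dirDeriv hU hz]
  have : IsSymmSndFDerivAt ℝ f z :=
    (hf.contDiffAt (hU.mem_nhds hz)).isSymmSndFDerivAt (by simpa using ENat.LEInfty.out)
  exact this u v

theorem dirDeriv_congr_of_eqOn {g : V → F} (hU : IsOpen U) (h : Set.EqOn f g U) (v : V) :
    Set.EqOn (dirDeriv v f) (dirDeriv v g) U := by
  intro z hz
  have : f =ᶠ[𝓝 z] g := h.eventuallyEq_of_mem (hU.mem_nhds hz)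
  simp only [dirDeriv, this.fderiv_eq]

theorem ContDiffOn.hasDerivAt_line (hf : ContDiffOn ℝ ∞ f U) (hU : IsOpen U) {z v : V} {s : ℝ}
    (hz : z + s • v ∈ U) :
    HasDerivAt (fun s : ℝ => f (z + s • v)) (_root_.dirDeriv v f (z + s • v)) s := by
  have h1 : HasDerivAt (fun s : ℝ => z + s • v) v s := by
    simpa using ((hasDerivAt_id s).smul_const v).const_add z
  exact (hf.hasFDerivAt_of_isOpen hU hz).comp_hasDerivAt s h1

theorem eventually_line_mem (hU : IsOpen U) {z : V} (hz : z ∈ U) (v : V) :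
    ∀ᶠ s : ℝ in 𝓝 0, z + s • v ∈ U := by
  have : ContinuousAt (fun s : ℝ => z + s • v) 0 := by fun_prop
  exact this.eventually (by simpa using hU.mem_nhds hz)

theorem ContDiffOn.hasTwoJet_line (hf : ContDiffOn ℝ ∞ f U) (hU : IsOpen U) {z : V} (hz : z ∈ U)
    (v : V) : HasTwoJet (fun s : ℝ => f (z + s • v)) (f z) (_root_.dirDeriv v f z)
      (_root_.dirDeriv v (_root_.dirDeriv v f) z) := by
  refine ⟨by simp, fun s => _root_.dirDeriv v f (z + s • v), by simp, ?_, ?_⟩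
  · filter_upwards [eventually_line_mem hU hz v] with s hs
    exact hf.hasDerivAt_line hU hs
  · simpa using (hf.dirDeriv hU v).hasDerivAt_line hU (z := z) (v := v) (s := 0) (by simpa using hz)

end Directional

/-! ### Regularity of `‖x‖ ^ p` -/

section NormPow

variable {E : Type*} [NormedAddCommGroup E] [InnerProductSpace ℝ E]

/-- Up to a factor this field is the gradient of `‖x‖ ^ (q + 2)`. At the origin it is `o(‖x‖)`;
elsewhere the chain rule applies to `(‖x‖²) ^ (q / 2)`. -/
theorem hasFDerivAt_norm_rpow_smul_self {q : ℝ} (hq : 0 < q) (x : E) :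
    HasFDerivAt (fun x : E => ‖x‖ ^ q • x)
      ((q * ‖x‖ ^ (q - 2)) • (innerSL ℝ x).smulRight x + ‖x‖ ^ q • ContinuousLinearMap.id ℝ E)
      x := by
  rcases eq_or_ne x 0 with rfl | hx
  · have h0 : (q * ‖(0 : E)‖ ^ (q - 2)) • (innerSL ℝ (0 : E)).smulRight (0 : E)
        + ‖(0 : E)‖ ^ q • ContinuousLinearMap.id ℝ E = 0 := by
      simp [Real.zero_rpow hq.ne']
    rw [h0, hasFDerivAt_iff_isLittleO]
    simp only [norm_zero, smul_zero, sub_zero, zero_apply]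
    rw [Asymptotics.isLittleO_iff]
    intro c hc
    have ht : Tendsto (fun x : E => ‖x‖ ^ q) (𝓝 0) (𝓝 0) := by
      have : Continuous fun x : E => ‖x‖ ^ q := continuous_norm.rpow_const fun _ => .inr hq.le
      simpa [Real.zero_rpow hq.ne'] using this.tendsto 0
    filter_upwards [ht.eventually (gt_mem_nhds hc)] with x hx
    rw [norm_smul, Real.norm_of_nonneg (by positivity)]
    gcongr
  · have h1 : HasFDerivAt (fun x : E => ‖x‖ ^ q) ((q * ‖x‖ ^ (q - 2)) • innerSL ℝ x) x := by
      have h2 : HasFDerivAt (fun x : E => (‖x‖ ^ 2) ^ (q / 2)) _ x :=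
        ((hasStrictFDerivAt_norm_sq x).hasFDerivAt).rpow_const
          (p := q / 2) (.inl (by positivity))
      have h3 : ∀ r : ℝ, ∀ y : E, (‖y‖ ^ 2) ^ r = ‖y‖ ^ (2 * r) := fun r y => by
        rw [← Real.rpow_natCast, ← Real.rpow_mul (norm_nonneg y)]; norm_num
      simp only [h3] at h2
      rw [show 2 * (q / 2) = q by ring, show 2 * (q / 2 - 1) = q - 2 by ring] at h2
      refine h2.congr_fderiv ?_
      ext y
      simp
      ring
    refine (h1.smul (hasFDerivAt_id x)).congr_fderiv ?_
    ext y
    simp [add_comm, smul_smul]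

theorem contDiff_one_norm_rpow_smul_self {q : ℝ} (hq : 0 < q) :
    ContDiff ℝ 1 (fun x : E => ‖x‖ ^ q • x) := by
  rw [contDiff_one_iff_hasFDerivAt]
  refine ⟨_, ?_, fun x => hasFDerivAt_norm_rpow_smul_self hq x⟩
  have hcq : Continuous fun x : E => ‖x‖ ^ q := continuous_norm.rpow_const fun _ => .inr hq.le
  refine Continuous.add ?_ (hcq.smul continuous_const)
  rw [continuous_iff_continuousAt]
  intro x
  rcases eq_or_ne x 0 with rfl | hx
  · have h0 : (q * ‖(0 : E)‖ ^ (q - 2)) • (innerSL ℝ (0 : E)).smulRight (0 : E) = 0 := by simp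
    rw [ContinuousAt, h0]
    have ht : Tendsto (fun x : E => q * ‖x‖ ^ q) (𝓝 0) (𝓝 0) := by
      simpa [Real.zero_rpow hq.ne'] using (hcq.const_mul q).tendsto 0
    -- The rank-one part of the derivative has norm `q ‖x‖ ^ q`, which tends to `0` at the origin
    -- although `‖x‖ ^ (q - 2)` may blow up.
    refine squeeze_zero_norm (fun x => ?_) ht
    rw [norm_smul, ContinuousLinearMap.norm_smulRight_apply, innerSL_apply_norm,
      Real.norm_of_nonneg (by positivity), mul_assoc]
    rcases eq_or_ne x 0 with rfl | hx
    · simp [Real.zero_rpow hq.ne']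
    · have : ‖x‖ ^ (q - 2) * (‖x‖ * ‖x‖) = ‖x‖ ^ q := by
        rw [← sq, ← Real.rpow_natCast, ← Real.rpow_add (norm_pos_iff.2 hx)]; norm_num
      rw [this]
  · have h1 : ContinuousAt (fun x : E => q * ‖x‖ ^ (q - 2)) x :=
      (continuousAt_const.mul ((continuous_norm.continuousAt).rpow_const
        (.inl (norm_ne_zero_iff.2 hx))))
    refine h1.smul ?_
    have : Continuous fun x : E => (innerSL ℝ x).smulRight x := by
      have h := (ContinuousLinearMap.smulRightL ℝ E E).continuous₂
      exact h.comp ((innerSL ℝ).continuous.prodMk continuous_id)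
    exact this.continuousAt

theorem contDiff_two_norm_rpow {p : ℝ} (hp : 2 ≤ p) : ContDiff ℝ 2 (fun x : E => ‖x‖ ^ p) := by
  rcases hp.eq_or_lt with rfl | hp
  -- The case `p = 2` is separate because the gradient field needs `q = p - 2 > 0`.
  · simpa using (contDiff_norm_sq ℝ : ContDiff ℝ 2 fun x : E => ‖x‖ ^ 2)
  · have h1 : ContDiff ℝ 1 (fun x : E => p • innerSL ℝ (‖x‖ ^ (p - 2) • x)) :=
      ((innerSL ℝ).contDiff.comp (contDiff_one_norm_rpow_smul_self (by linarith))).const_smul p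
    rw [show (2 : WithTop ℕ∞) = (1 : ℕ) + 1 by norm_num, contDiff_succ_iff_hasFDerivAt]
    refine ⟨_, by simpa using h1, fun x => (hasFDerivAt_norm_rpow x (by linarith)).congr_fderiv ?_⟩
    simp [smul_smul]

end NormPow

/-! ### Trace inequality and convexity criteria -/

/-- The trace of the product of a matrix with nonnegative quadratic form and a positive
semidefinite matrix is nonnegative. -/
theorem sum_mul_nonneg_of_posSemidef {ι : Type*} [Fintype ι] {A B : Matrix ι ι ℝ}
    (hA : ∀ ξ : ι → ℝ, 0 ≤ ∑ i, ∑ j, A i j * ξ i * ξ j) (hB : B.PosSemidef) :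
    0 ≤ ∑ i, ∑ j, A i j * B i j := by
  classical
  -- `B` is a sum of rank-one matrices, and each contributes a value of the quadratic form of `A`.
  obtain ⟨m, C, hC⟩ := Matrix.posSemidef_iff_eq_sum_vecMulVec.mp hB
  have : ∑ i, ∑ j, A i j * B i j = ∑ k, ∑ i, ∑ j, A i j * C k i * C k j := by
    rw [Finset.sum_comm' (t' := Finset.univ) (s' := fun _ => Finset.univ) (by simp)]
    rw [Finset.sum_comm]
    conv_rhs => rw [Finset.sum_comm]
    refine Finset.sum_congr rfl fun i _ => ?_
    conv_rhs => rw [Finset.sum_comm]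
    refine Finset.sum_congr rfl fun j _ => ?_
    rw [hC, Matrix.sum_apply, Finset.mul_sum]
    refine Finset.sum_congr rfl fun k _ => ?_
    simp [Matrix.vecMulVec_apply, mul_assoc]
  rw [this]
  exact Finset.sum_nonneg fun k _ => hA _

/-- A `C²` function on a convex open set with nonnegative second derivative is convex. -/
theorem convexOn_of_fderiv_fderiv_nonneg {E : Type*} [NormedAddCommGroup E] [NormedSpace ℝ E]
    {Ω : Set E} (hΩ : IsOpen Ω) (hc : Convex ℝ Ω) {u : E → ℝ} (hu : ContDiffOn ℝ 2 u Ω)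
    (h : ∀ x ∈ Ω, ∀ v : E, 0 ≤ fderiv ℝ (fderiv ℝ u) x v v) : ConvexOn ℝ Ω u := by
  refine ⟨hc, fun x hx y hy α β hα hβ hαβ => ?_⟩
  let φ : ℝ → ℝ := fun s => u (x + s • (y - x))
  have hmem : ∀ s ∈ Set.Icc (0 : ℝ) 1, x + s • (y - x) ∈ Ω := fun s hs =>
    hc.add_smul_sub_mem hx hy hs
  have hl : ∀ s : ℝ, HasDerivAt (fun s : ℝ => x + s • (y - x)) (y - x) s := fun s => by
    simpa using ((hasDerivAt_id s).smul_const (y - x)).const_add x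
  have h1 : ∀ s ∈ Set.Icc (0 : ℝ) 1,
      HasDerivAt φ (fderiv ℝ u (x + s • (y - x)) (y - x)) s := fun s hs =>
    (((hu.contDiffAt (hΩ.mem_nhds (hmem s hs))).differentiableAt
      (by norm_num)).hasFDerivAt).comp_hasDerivAt s (hl s)
  have h2 : ∀ s ∈ Set.Icc (0 : ℝ) 1,
      HasDerivAt (fun s : ℝ => fderiv ℝ u (x + s • (y - x)) (y - x))
        (fderiv ℝ (fderiv ℝ u) (x + s • (y - x)) (y - x) (y - x)) s := fun s hs => by
    have h3 : ContDiffAt ℝ 1 (fderiv ℝ u) (x + s • (y - x)) :=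
      (hu.contDiffAt (hΩ.mem_nhds (hmem s hs))).fderiv_right (by norm_num)
    have h4 : HasDerivAt (fun s : ℝ => fderiv ℝ u (x + s • (y - x))) _ s :=
      ((h3.differentiableAt (by norm_num)).hasFDerivAt).comp_hasDerivAt s (hl s)
    simpa using h4.clm_apply (hasDerivAt_const s (y - x))
  have hconv : ConvexOn ℝ (Set.Icc (0 : ℝ) 1) φ := by
    refine convexOn_of_hasDerivWithinAt2_nonneg (convex_Icc 0 1)
      (fun s hs => (h1 s hs).continuousAt.continuousWithinAt)
      (fun s hs => (h1 s (interior_subset hs)).hasDerivWithinAt)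
      (fun s hs => (h2 s (interior_subset hs)).hasDerivWithinAt)
      (fun s hs => h _ (hmem s (interior_subset hs)) _)
  have := hconv.2 (Set.left_mem_Icc.2 zero_le_one) (Set.right_mem_Icc.2 zero_le_one) hα hβ hαβ
  have e : x + β • (y - x) = α • x + β • y := by
    rw [← eq_sub_iff_add_eq] at hαβ; subst hαβ; module
  simpa [φ, e] using this

theorem ConvexOn.deriv_deriv_nonneg_of_isOpen {s : Set ℝ} (hs : IsOpen s) {b : ℝ → ℝ}
    (hb : ConvexOn ℝ s b) (hd : ContDiffOn ℝ 2 b s) {x : ℝ} (hx : x ∈ s) :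
    0 ≤ deriv (deriv b) x := by
  have hm : MonotoneOn (deriv b) s := hb.monotoneOn_deriv fun y hy =>
    (hd.contDiffAt (hs.mem_nhds hy)).differentiableAt (by norm_num)
  rw [← derivWithin_of_mem_nhds (hs.mem_nhds hx)]
  exact hm.derivWithin_nonneg

/-! ### Commuting and summing directional derivatives -/

section DirectionalAlgebra

variable {V F : Type*} [NormedAddCommGroup V] [NormedSpace ℝ V] [NormedAddCommGroup F]
  [NormedSpace ℝ F] {U : Set V}

theorem ContDiffOn.dirDeriv_pair_comm {f : V → F} (hf : ContDiffOn ℝ ∞ f U) (hU : IsOpen U) {z : V}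
    (hz : z ∈ U) (u v : V) :
    _root_.dirDeriv v (_root_.dirDeriv v (_root_.dirDeriv u (_root_.dirDeriv u f))) z =
      _root_.dirDeriv u (_root_.dirDeriv u (_root_.dirDeriv v (_root_.dirDeriv v f))) z := by
  have h1 := dirDeriv_congr_of_eqOn hU
    (fun y hy => (hf.dirDeriv hU u).dirDeriv_comm hU hy v u) v hz
  have h2 := ((hf.dirDeriv hU u).dirDeriv hU v).dirDeriv_comm hU hz v u
  have h3 := dirDeriv_congr_of_eqOn hU (dirDeriv_congr_of_eqOn hU
    (fun y hy => hf.dirDeriv_comm hU hy v u) v) u hz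
  have h4 := dirDeriv_congr_of_eqOn hU
    (fun y hy => (hf.dirDeriv hU v).dirDeriv_comm hU hy v u) u hz
  exact h1.trans (h2.trans (h3.trans h4))

theorem dirDeriv_sum_const_mul {ι : Type*} (t : Finset ι) (hU : IsOpen U) {f : ι → V → ℝ}
    (hf : ∀ i, ContDiffOn ℝ ∞ (f i) U) (c : ι → ℝ) (v : V) :
    Set.EqOn (dirDeriv v fun z => ∑ i ∈ t, c i * f i z)
      (fun z => ∑ i ∈ t, c i * dirDeriv v (f i) z) U := by
  intro z hz
  have h : HasFDerivAt (fun z => ∑ i ∈ t, c i * f i z) (∑ i ∈ t, c i • fderiv ℝ (f i) z) z :=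
    HasFDerivAt.fun_sum fun i _ => ((hf i).hasFDerivAt_of_isOpen hU hz).const_mul (c i)
  simp [dirDeriv, h.fderiv]

end DirectionalAlgebra

/-! ### Space and time derivatives on the cylinder -/

section Cylinder

variable {n : ℕ} {Ω : Set (EuclideanSpace ℝ (Fin n))} {w : EuclideanSpace ℝ (Fin n) → ℝ → ℝ}

local notation "𝔼" => EuclideanSpace ℝ (Fin n)

/-- The derivative of a function of `(x, t)` in the spatial direction `v`. -/
noncomputable abbrev spaceDeriv {n : ℕ} (v : EuclideanSpace ℝ (Fin n))
    (f : EuclideanSpace ℝ (Fin n) × ℝ → ℝ) : EuclideanSpace ℝ (Fin n) × ℝ → ℝ :=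
  dirDeriv (v, (0 : ℝ)) f

theorem spaceDeriv_congr_of_eqOn {f g : 𝔼 × ℝ → ℝ} {U : Set (𝔼 × ℝ)} (hU : IsOpen U)
    (h : Set.EqOn f g U) (v : 𝔼) : Set.EqOn (spaceDeriv v f) (spaceDeriv v g) U :=
  dirDeriv_congr_of_eqOn hU h _

theorem isOpen_cylinder (hΩ : IsOpen Ω) : IsOpen (Ω ×ˢ Set.Ioi (0 : ℝ)) := hΩ.prod isOpen_Ioi

theorem spaceHess_eq_fderiv_fderiv (hΩ : IsOpen Ω) {x : 𝔼} (hx : x ∈ Ω) (t : ℝ) (u v : 𝔼) :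
    spaceHess Ω w x t u v = fderiv ℝ (fderiv ℝ fun y => w y t) x u v := by
  have h : closure Ω =ᶠ[𝓝 x] Set.univ := by
    rw [eventuallyEq_univ]
    exact mem_of_superset (hΩ.mem_nhds hx) subset_closure
  rw [spaceHess, iteratedFDerivWithin_congr_set h, iteratedFDerivWithin_univ,
    iteratedFDeriv_two_apply]
  rfl

theorem fderiv_slice (hΩ : IsOpen Ω)
    (hW : ContDiffOn ℝ ∞ (fun z : 𝔼 × ℝ => w z.1 z.2) (Ω ×ˢ Set.Ioi 0)) {z : 𝔼 × ℝ}
    (hz : z ∈ Ω ×ˢ Set.Ioi (0 : ℝ)) (v : 𝔼) :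
    fderiv ℝ (fun y => w y z.2) z.1 v = spaceDeriv v (fun z : 𝔼 × ℝ => w z.1 z.2) z := by
  have h1 := hW.hasFDerivAt_of_isOpen (isOpen_cylinder hΩ) hz
  have h2 : HasFDerivAt (fun y : 𝔼 => (y, z.2)) (ContinuousLinearMap.inl ℝ 𝔼 ℝ) z.1 :=
    hasFDerivAt_prodMk_left z.1 z.2
  have h3 : HasFDerivAt (fun y => w y z.2) _ z.1 :=
    HasFDerivAt.comp (g := fun z : 𝔼 × ℝ => w z.1 z.2) z.1 h1 h2
  rw [h3.fderiv]
  rfl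

theorem spaceHess_eq_spaceDeriv (hΩ : IsOpen Ω)
    (hW : ContDiffOn ℝ ∞ (fun z : 𝔼 × ℝ => w z.1 z.2) (Ω ×ˢ Set.Ioi 0)) {z : 𝔼 × ℝ}
    (hz : z ∈ Ω ×ˢ Set.Ioi (0 : ℝ)) (u v : 𝔼) :
    spaceHess Ω w z.1 z.2 u v =
      spaceDeriv u (spaceDeriv v (fun z : 𝔼 × ℝ => w z.1 z.2)) z := by
  rw [spaceHess_eq_fderiv_fderiv hΩ hz.1]
  have hU := isOpen_cylinder hΩ
  have hsl : ContDiffOn ℝ ∞ (fun y => w y z.2) Ω :=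
    hW.comp (f := fun y : 𝔼 => (y, z.2)) (by fun_prop) fun y hy => ⟨hy, hz.2⟩
  rw [← hsl.dirDeriv_dirDeriv hΩ hz.1]
  have h1 : Set.EqOn (dirDeriv v fun y => w y z.2)
      (fun y => spaceDeriv v (fun z : 𝔼 × ℝ => w z.1 z.2) (y, z.2)) Ω := fun y hy =>
    fderiv_slice hΩ hW (z := (y, z.2)) ⟨hy, hz.2⟩ v
  rw [dirDeriv_congr_of_eqOn hΩ h1 u hz.1]
  exact fderiv_slice (w := fun y t => spaceDeriv v (fun z : 𝔼 × ℝ => w z.1 z.2) (y, t)) hΩ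
    (hW.dirDeriv hU _) hz u

theorem deriv_time_eq_dirDeriv (hΩ : IsOpen Ω)
    (hW : ContDiffOn ℝ ∞ (fun z : 𝔼 × ℝ => w z.1 z.2) (Ω ×ˢ Set.Ioi 0)) {z : 𝔼 × ℝ}
    (hz : z ∈ Ω ×ˢ Set.Ioi (0 : ℝ)) :
    HasDerivAt (fun s => w z.1 s) (dirDeriv ((0 : 𝔼), (1 : ℝ)) (fun z : 𝔼 × ℝ => w z.1 z.2) z)
      z.2 := by
  have h1 := hW.hasFDerivAt_of_isOpen (isOpen_cylinder hΩ) hz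
  exact HasFDerivAt.comp_hasDerivAt (l := fun z : 𝔼 × ℝ => w z.1 z.2) (f := fun s => (z.1, s))
    z.2 h1 ((hasDerivAt_const z.2 z.1).prodMk (hasDerivAt_id z.2))

theorem inner_spaceGrad (hΩ : IsOpen Ω)
    (hW : ContDiffOn ℝ ∞ (fun z : 𝔼 × ℝ => w z.1 z.2) (Ω ×ˢ Set.Ioi 0)) {z : 𝔼 × ℝ}
    (hz : z ∈ Ω ×ˢ Set.Ioi (0 : ℝ)) (v : 𝔼) :
    inner ℝ (spaceGrad w z.1 z.2) v = spaceDeriv v (fun z : 𝔼 × ℝ => w z.1 z.2) z := by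
  rw [← fderiv_slice hΩ hW hz, spaceGrad, gradient, InnerProductSpace.toDual_symm_apply]

theorem contDiffOn_spaceGrad (hΩ : IsOpen Ω)
    (hW : ContDiffOn ℝ ∞ (fun z : 𝔼 × ℝ => w z.1 z.2) (Ω ×ˢ Set.Ioi 0)) :
    ContDiffOn ℝ ∞ (fun z : 𝔼 × ℝ => spaceGrad w z.1 z.2) (Ω ×ˢ Set.Ioi 0) := by
  rw [contDiffOn_euclidean]
  intro i
  refine (hW.dirDeriv (isOpen_cylinder hΩ) (EuclideanSpace.single i (1 : ℝ), (0 : ℝ))).congr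
    fun z hz => ?_
  refine Eq.trans ?_ (inner_spaceGrad hΩ hW hz _)
  simp [EuclideanSpace.inner_single_right]

theorem inner_dirDeriv {V F : Type*} [NormedAddCommGroup V] [NormedSpace ℝ V]
    [NormedAddCommGroup F] [InnerProductSpace ℝ F] {U : Set V} (hU : IsOpen U) {Γ : V → F}
    (hΓ : ContDiffOn ℝ ∞ Γ U) {z : V} (hz : z ∈ U) (η : V) (v : F) :
    inner ℝ (dirDeriv η Γ z) v = dirDeriv η (fun z => inner ℝ (Γ z) v) z := by
  have h := (hΓ.hasFDerivAt_of_isOpen hU hz).inner ℝ (hasFDerivAt_const v z)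
  simp [dirDeriv, h.fderiv]

/-- Reduces derivatives of the vector field `∇w` to scalar derivatives of `w`, by pairing with an
arbitrary `v`. -/
theorem inner_dirDeriv_spaceGrad (hΩ : IsOpen Ω)
    (hW : ContDiffOn ℝ ∞ (fun z : 𝔼 × ℝ => w z.1 z.2) (Ω ×ˢ Set.Ioi 0)) (η : 𝔼 × ℝ) (v : 𝔼) :
    Set.EqOn (fun z => inner ℝ (dirDeriv η (fun z : 𝔼 × ℝ => spaceGrad w z.1 z.2) z) v)
      (dirDeriv η (spaceDeriv v (fun z : 𝔼 × ℝ => w z.1 z.2))) (Ω ×ˢ Set.Ioi 0) := by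
  intro z hz
  have hU := isOpen_cylinder hΩ
  exact (inner_dirDeriv hU (contDiffOn_spaceGrad hΩ hW) hz η v).trans
    (dirDeriv_congr_of_eqOn hU (fun y hy => inner_spaceGrad hΩ hW hy v) η hz)

/-- The second spatial derivatives of `w`, and their derivatives along a fixed direction, are
quadratic in the direction. -/
theorem spaceDeriv_spaceDeriv_eqOn_sum (hΩ : IsOpen Ω) {W : 𝔼 × ℝ → ℝ}
    (hW : ContDiffOn ℝ ∞ W (Ω ×ˢ Set.Ioi 0)) (ξ : Fin n → ℝ) :
    Set.EqOn (spaceDeriv (∑ i, ξ i • EuclideanSpace.single i (1 : ℝ))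
        (spaceDeriv (∑ i, ξ i • EuclideanSpace.single i (1 : ℝ)) W))
      (fun z => ∑ k : Fin n × Fin n, ξ k.1 * ξ k.2 *
        spaceDeriv (EuclideanSpace.single k.1 1) (spaceDeriv (EuclideanSpace.single k.2 1) W) z)
      (Ω ×ˢ Set.Ioi 0) := by
  intro z hz
  have hU := isOpen_cylinder hΩ
  have e : ((∑ i, ξ i • EuclideanSpace.single i (1 : ℝ), (0 : ℝ)) : 𝔼 × ℝ)
      = ∑ i, ξ i • ((EuclideanSpace.single i (1 : ℝ), (0 : ℝ)) : 𝔼 × ℝ) := by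
    ext <;> simp [Prod.fst_sum, Prod.snd_sum]
  simp only [spaceDeriv, hW.dirDeriv_dirDeriv hU hz, e, map_sum, map_smul,
    sum_apply, smul_apply, Fintype.sum_prod_type,
    smul_eq_mul, Finset.mul_sum]
  rw [Finset.sum_comm]
  exact Finset.sum_congr rfl fun i _ => Finset.sum_congr rfl fun j _ => by ring

end Cylinder

/-! ### The twice differentiated equation at a touching point -/

/-- Completing the square in the twice differentiated second order term: with `r'' = r'² / (2 r)`
it is, up to terms of order `μ`, the trace against `A` of the second variation in
the direction of a moving vector. -/
theorem second_order_term_eq {ι : Type*} [Fintype ι] (A A₁ A₂ h h₁ h₂ δ : ι → ι → ℝ)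
    {r r₁ r₂ d μ c : ℝ} (hr : r ≠ 0) (hr₂ : r₂ = r₁ ^ 2 / (2 * r)) (hc : c = r₁ * d / (2 * r)) :
    (r₂ * d ^ 2 + r₁ * -μ) * (∑ i, ∑ j, A i j * h i j)
      + 2 * ((r₁ * d) * ∑ i, ∑ j, (-μ * A₁ i j * h i j + A i j * h₁ i j))
      + r * ∑ i, ∑ j, (μ ^ 2 * A₂ i j * h i j + 2 * (-μ * A₁ i j * h₁ i j) + A i j * h₂ i j)
    = r * (∑ i, ∑ j, A i j * (h₂ i j + 4 * c * h₁ i j + 2 * c ^ 2 * h i j + 2 * c ^ 2 * μ * δ i j))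
      + μ * ∑ i, ∑ j, (-(r₁ * A i j * h i j) - 2 * (r₁ * d * A₁ i j * h i j)
        + r * (μ * A₂ i j * h i j - 2 * (A₁ i j * h₁ i j)) - r₂ * d ^ 2 * A i j * δ i j) := by
  simp only [Finset.mul_sum, ← Finset.sum_add_distrib]
  refine Finset.sum_congr rfl fun i _ => Finset.sum_congr rfl fun j _ => ?_
  -- The choice of `c` gives `4 c r = 2 r₁ d` and `2 c² r = r₁² d² / (2 r) = r₂ d²`.
  subst hr₂ hc
  field_simp
  ring

/-- The matrix of a quadratic form in `v` that is evaluated on coordinates. -/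
theorem Matrix.posSemidef_of_sum_nonneg {ι : Type*} [Fintype ι] {B : Matrix ι ι ℝ}
    (hs : ∀ i j, B i j = B j i) (h : ∀ ξ : ι → ℝ, 0 ≤ ∑ k : ι × ι, ξ k.1 * ξ k.2 * B k.1 k.2) :
    B.PosSemidef := by
  refine Matrix.PosSemidef.of_dotProduct_mulVec_nonneg ?_ fun ξ => ?_
  · ext i j
    simpa using hs j i
  · have := h ξ
    rw [Fintype.sum_prod_type] at this
    refine this.trans_eq ?_
    simp only [dotProduct, Matrix.mulVec, Finset.mul_sum]
    refine Finset.sum_congr rfl fun i _ => Finset.sum_congr rfl fun j _ => ?_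
    rw [star_trivial]
    ring

/-- The first order terms left after differentiating `b(u) G(∇u)` twice at a touching point. -/
noncomputable def lowerOrderRemainder {E : Type*} [NormedAddCommGroup E] [NormedSpace ℝ E]
    (b : ℝ → ℝ) (G : E → ℝ) (u d : ℝ) (q e : E) (μ : ℝ) : ℝ :=
  -(deriv b u * G q) - 2 * (deriv b u * d * fderiv ℝ G q e)
    + b u * (μ * fderiv ℝ (fderiv ℝ G) q e e)

/-- As `u'' = -μ`, `γ' = -μ e` and `γ'' = 0`, every term except `b'' d² G` carries a factor `μ`.
That term is kept apart because convexity of `b` gives it a sign when `G ≥ 0`. -/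
theorem hasTwoJet_lowerOrder {E : Type*} [NormedAddCommGroup E] [NormedSpace ℝ E]
    {b : ℝ → ℝ} {G : E → ℝ} (hb : ContDiffOn ℝ 2 b (Set.Ioi 0)) (hG : ContDiff ℝ 2 G)
    {u : ℝ → ℝ} {γ : ℝ → E} {u₀ d μ : ℝ} {q e : E} (hu₀ : 0 < u₀)
    (hu : HasTwoJet u u₀ d (-μ)) (hγ : HasTwoJet γ q (-μ • e) 0) :
    ∃ b₁, HasTwoJet (fun s => b (u s) * G (γ s)) (b u₀ * G q) b₁
      (deriv (deriv b) u₀ * d ^ 2 * G q + μ * lowerOrderRemainder b G u₀ d q e μ) := by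
  refine ⟨_, ((hu.comp_real isOpen_Ioi hb hu₀).mul
    (hγ.comp isOpen_univ hG.contDiffOn (Set.mem_univ _))).congr_val rfl rfl ?_⟩
  simp only [map_smul, map_zero, smul_apply, smul_eq_mul, lowerOrderRemainder]
  ring

section Touching

variable {n : ℕ} {Ω : Set (EuclideanSpace ℝ (Fin n))} {w : EuclideanSpace ℝ (Fin n) → ℝ → ℝ}

local notation "𝔼" => EuclideanSpace ℝ (Fin n)

/-- The terms of order `μ` in the twice differentiated equation at a touching point, divided by
`μ`. -/
noncomputable def touchingRemainder {n : ℕ} (p : ℝ)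
    (a : EuclideanSpace ℝ (Fin n) → Matrix (Fin n) (Fin n) ℝ) (ρ b₁ b₂ b₃ : ℝ → ℝ)
    (w : EuclideanSpace ℝ (Fin n) → ℝ → ℝ) (z : EuclideanSpace ℝ (Fin n) × ℝ)
    (e : EuclideanSpace ℝ (Fin n)) (μ : ℝ) : ℝ :=
  let W := fun z : EuclideanSpace ℝ (Fin n) × ℝ => w z.1 z.2
  let b := fun i : Fin n => EuclideanSpace.single i (1 : ℝ)
  let u := w z.1 z.2
  let d := spaceDeriv e W z
  let q := spaceGrad w z.1 z.2
  (∑ i, ∑ j, (-(deriv ρ u * a q i j * spaceDeriv (b i) (spaceDeriv (b j) W) z)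
      - 2 * (deriv ρ u * d * fderiv ℝ (fun q => a q i j) q e *
        spaceDeriv (b i) (spaceDeriv (b j) W) z)
      + ρ u * (μ * fderiv ℝ (fderiv ℝ (fun q => a q i j)) q e e *
          spaceDeriv (b i) (spaceDeriv (b j) W) z
        - 2 * (fderiv ℝ (fun q => a q i j) q e *
          spaceDeriv e (spaceDeriv (b i) (spaceDeriv (b j) W)) z))
      - deriv (deriv ρ) u * d ^ 2 * a q i j * inner ℝ (b i) (b j)))
    + lowerOrderRemainder b₁ (fun q => ‖q‖ ^ p) u d q e μ
    + lowerOrderRemainder b₂ (fun q => ‖q‖ ^ 2) u d q e μ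
    + lowerOrderRemainder b₃ (fun _ => 1) u d q e μ

/-- At a point where `w_ee + μ` touches zero from above, the equation bounds `w_eet` from below. -/
theorem dirDeriv_time_ge_of_touching (hΩ : IsOpen Ω)
    {p : ℝ} (hp : 2 ≤ p) {a : 𝔼 → Matrix (Fin n) (Fin n) ℝ}
    (ha_smooth : ∀ i j, ContDiff ℝ ∞ (fun q => a q i j))
    (ha : ∀ q ξ : 𝔼, 0 ≤ ∑ i, ∑ j, a q i j * ξ i * ξ j)
    {ρ b₁ b₂ b₃ : ℝ → ℝ} (hρ_smooth : ContDiff ℝ ∞ ρ) (hρ_pos : ∀ s : ℝ, s ≠ 0 → 0 < ρ s)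
    (hρ_ode : ∀ s : ℝ, s ≠ 0 → deriv (deriv ρ) s - (deriv ρ s) ^ 2 / (2 * ρ s) = 0)
    (hb₁_smooth : ContDiffOn ℝ ∞ b₁ (Set.Ioi 0)) (hb₁_convex : ConvexOn ℝ (Set.Ioi 0) b₁)
    (hb₂_smooth : ContDiffOn ℝ ∞ b₂ (Set.Ioi 0)) (hb₂_convex : ConvexOn ℝ (Set.Ioi 0) b₂)
    (hb₃_smooth : ContDiffOn ℝ ∞ b₃ (Set.Ioi 0)) (hb₃_convex : ConvexOn ℝ (Set.Ioi 0) b₃)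
    {W : 𝔼 × ℝ → ℝ} (hWw : W = fun z : 𝔼 × ℝ => w z.1 z.2)
    (hW : ContDiffOn ℝ ∞ W (Ω ×ˢ Set.Ioi 0))
    (hw_eq : SolvesEquation Ω p a ρ b₁ b₂ b₃ w)
    {z : 𝔼 × ℝ} (hz : z ∈ Ω ×ˢ Set.Ioi (0 : ℝ)) (hpos : 0 < w z.1 z.2) {e : 𝔼} {μ : ℝ}
    (he : ‖e‖ = 1)
    (hnull : ∀ v, spaceDeriv e (spaceDeriv v W) z = -μ * inner ℝ e v)
    (hcrit : ∀ v, spaceDeriv v (spaceDeriv e (spaceDeriv e W)) z = 0)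
    (hsecond : ∀ (c : ℝ) (v : 𝔼), 0 ≤
      spaceDeriv e (spaceDeriv e (spaceDeriv v (spaceDeriv v W))) z
        + 4 * c * spaceDeriv e (spaceDeriv v (spaceDeriv v W)) z
        + 2 * c ^ 2 * spaceDeriv v (spaceDeriv v W) z + 2 * c ^ 2 * μ * ‖v‖ ^ 2) :
    μ * touchingRemainder p a ρ b₁ b₂ b₃ w z e μ ≤
      dirDeriv ((0 : 𝔼), (1 : ℝ)) (spaceDeriv e (spaceDeriv e W)) z := by
  have hU : IsOpen (Ω ×ˢ Set.Ioi (0 : ℝ)) := isOpen_cylinder hΩ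
  set U := Ω ×ˢ Set.Ioi (0 : ℝ)
  set Γ : 𝔼 × ℝ → 𝔼 := fun z => spaceGrad w z.1 z.2 with hΓ
  let b := fun i : Fin n => EuclideanSpace.single i (1 : ℝ)
  let η : 𝔼 × ℝ := (e, 0)
  have hWs : ContDiffOn ℝ ∞ (fun z : 𝔼 × ℝ => w z.1 z.2) U := hWw ▸ hW
  have hΓs : ContDiffOn ℝ ∞ Γ U := contDiffOn_spaceGrad hΩ hWs
  have hΓv : ∀ η' v, Set.EqOn (fun z => inner ℝ (dirDeriv η' Γ z) v)
      (dirDeriv η' (spaceDeriv v W)) U := fun η' v => hWw ▸ inner_dirDeriv_spaceGrad hΩ hWs η' v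
  set d := spaceDeriv e W z with hd
  have hu : HasTwoJet (fun s : ℝ => W (z + s • η)) (W z) d (-μ) :=
    (hW.hasTwoJet_line hU hz η).congr_val rfl rfl (by simpa [he] using hnull e)
  -- Paired with `v`, the velocity of `∇w` is `w_{ev}`, known from `hnull`; the acceleration is
  -- `w_{eev}`, zero by `hcrit`.
  have hγ : HasTwoJet (fun s : ℝ => Γ (z + s • η)) (Γ z) (-μ • e) 0 := by
    refine (hΓs.hasTwoJet_line hU hz η).congr_val rfl ?_ ?_
    · refine ext_inner_right ℝ fun v => ?_
      rw [inner_smul_left]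
      simpa using (hΓv η v hz).trans (hnull v)
    · refine ext_inner_right ℝ fun v => ?_
      rw [inner_zero_left, inner_dirDeriv hU (hΓs.dirDeriv hU η) hz,
        dirDeriv_congr_of_eqOn hU (hΓv η v) η hz,
        dirDeriv_congr_of_eqOn hU (fun y hy => hW.dirDeriv_comm hU hy η (v, 0)) η hz,
        (hW.dirDeriv hU η).dirDeriv_comm hU hz]
      exact hcrit v
  have hh : ∀ i j, ContDiffOn ℝ ∞ (spaceDeriv (b i) (spaceDeriv (b j) W)) U := fun i j =>
    (hW.dirDeriv hU _).dirDeriv hU _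
  have hρj := hu.comp_real isOpen_univ ((hρ_smooth.of_le ENat.LEInfty.out).contDiffOn)
    (Set.mem_univ _)
  have hAj : ∀ i j, HasTwoJet
      (fun s : ℝ => a (Γ (z + s • η)) i j * spaceDeriv (b i) (spaceDeriv (b j) W) (z + s • η))
      _ _ _ := fun i j =>
    (hγ.comp (G := fun q => a q i j) isOpen_univ
      (((ha_smooth i j).of_le ENat.LEInfty.out).contDiffOn) (Set.mem_univ _)).mul
      ((hh i j).hasTwoJet_line hU hz η)
  have hsum := HasTwoJet.sum Finset.univ fun i => HasTwoJet.sum Finset.univ fun j => hAj i j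
  have hWpos : 0 < W z := by rw [hWw]; exact hpos
  obtain ⟨c₁, hB₁⟩ := hasTwoJet_lowerOrder (hb₁_smooth.of_le ENat.LEInfty.out)
    (contDiff_two_norm_rpow hp) hWpos hu hγ
  obtain ⟨c₂, hB₂⟩ := hasTwoJet_lowerOrder (hb₂_smooth.of_le ENat.LEInfty.out)
    (contDiff_norm_sq ℝ) hWpos hu hγ
  obtain ⟨c₃, hB₃⟩ := hasTwoJet_lowerOrder (G := fun _ : 𝔼 => (1 : ℝ))
    (hb₃_smooth.of_le ENat.LEInfty.out) contDiff_const hWpos hu hγ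
  have hR := (((hρj.mul hsum).add hB₁).add hB₂).add hB₃
  have hLj := (hW.dirDeriv hU ((0 : 𝔼), (1 : ℝ))).hasTwoJet_line hU hz η
  -- Both sides of the equation are equal along the line, so their second derivatives at `z` agree.
  have hval := (hLj.unique hR (by
    filter_upwards [eventually_line_mem hU hz η] with s hs
    have h1 := hw_eq _ hs.1 _ hs.2
    rw [(deriv_time_eq_dirDeriv hΩ hWs hs).deriv] at h1
    simp only [spaceHess_eq_spaceDeriv hΩ hWs hs] at h1
    simpa only [hWw, hΓ, b, mul_one] using h1)).2.2
  have hcomm : dirDeriv ((0 : 𝔼), (1 : ℝ)) (spaceDeriv e (spaceDeriv e W)) z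
      = dirDeriv η (dirDeriv η (dirDeriv ((0 : 𝔼), (1 : ℝ)) W)) z := by
    rw [(hW.dirDeriv hU η).dirDeriv_comm hU hz]
    exact dirDeriv_congr_of_eqOn hU (fun y hy => hW.dirDeriv_comm hU hy _ _) η hz
  have hWz : W z = w z.1 z.2 := by rw [hWw]
  set r := ρ (W z) with hr
  have hrpos : 0 < r := hρ_pos _ hWpos.ne'
  set c := deriv ρ (W z) * d / (2 * r) with hc
  let B : Matrix (Fin n) (Fin n) ℝ := fun i j =>
    spaceDeriv e (spaceDeriv e (spaceDeriv (b i) (spaceDeriv (b j) W))) z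
      + 4 * c * spaceDeriv e (spaceDeriv (b i) (spaceDeriv (b j) W)) z
      + 2 * c ^ 2 * spaceDeriv (b i) (spaceDeriv (b j) W) z
      + 2 * c ^ 2 * μ * inner ℝ (b i) (b j)
  have hBpsd : B.PosSemidef := by
    refine Matrix.posSemidef_of_sum_nonneg (fun i j => ?_) fun ξ => ?_
    · have h0 : Set.EqOn (spaceDeriv (b i) (spaceDeriv (b j) W))
          (spaceDeriv (b j) (spaceDeriv (b i) W)) U := fun y hy => hW.dirDeriv_comm hU hy _ _
      have h1 := spaceDeriv_congr_of_eqOn hU h0 e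
      have h2 := spaceDeriv_congr_of_eqOn hU h1 e
      simp only [B]
      rw [h0 hz, h1 hz, h2 hz, real_inner_comm]
    -- The form of `B` at `ξ` is `hsecond` for `v = ∑ ξ i • b i`, expanded in coordinates.
    · have hv := hsecond c (∑ i, ξ i • b i)
      have h0 : Set.EqOn (spaceDeriv (∑ i, ξ i • b i) (spaceDeriv (∑ i, ξ i • b i) W))
          (fun z => ∑ k : Fin n × Fin n, ξ k.1 * ξ k.2 *
            spaceDeriv (b k.1) (spaceDeriv (b k.2) W) z) U :=
        spaceDeriv_spaceDeriv_eqOn_sum hΩ hW ξ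
      have hs1 := dirDeriv_sum_const_mul (Finset.univ : Finset (Fin n × Fin n)) hU
        (fun k => hh k.1 k.2) (fun k => ξ k.1 * ξ k.2) (e, (0 : ℝ))
      have hs2 := dirDeriv_sum_const_mul (Finset.univ : Finset (Fin n × Fin n)) hU
        (fun k => (hh k.1 k.2).dirDeriv hU (e, (0 : ℝ))) (fun k => ξ k.1 * ξ k.2) (e, (0 : ℝ))
      have h1 := (spaceDeriv_congr_of_eqOn hU h0 e).trans hs1
      have h2 := (spaceDeriv_congr_of_eqOn hU h1 e).trans hs2
      have h3 : ‖∑ i, ξ i • b i‖ ^ 2 = ∑ k : Fin n × Fin n, ξ k.1 * ξ k.2 *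
          inner ℝ (b k.1) (b k.2) := by
        rw [← real_inner_self_eq_norm_sq, sum_inner, Fintype.sum_prod_type]
        refine Finset.sum_congr rfl fun i _ => ?_
        rw [inner_sum]
        refine Finset.sum_congr rfl fun j _ => ?_
        rw [real_inner_smul_left, real_inner_smul_right]
        ring
      rw [h0 hz, h1 hz, h2 hz, h3] at hv
      refine hv.trans_eq ?_
      simp only [Finset.mul_sum, ← Finset.sum_add_distrib]
      refine Finset.sum_congr rfl fun k _ => ?_
      simp only [B]
      ring
  have htr : 0 ≤ ∑ i, ∑ j, a (Γ z) i j * B i j :=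
    sum_mul_nonneg_of_posSemidef (fun ξ => ha (Γ z) (WithLp.toLp 2 ξ)) hBpsd
  have hode : deriv (deriv ρ) (W z) = deriv ρ (W z) ^ 2 / (2 * r) := by
    linarith [hρ_ode (W z) hWpos.ne']
  have hid := second_order_term_eq (fun i j => a (Γ z) i j)
    (fun i j => fderiv ℝ (fun q => a q i j) (Γ z) e)
    (fun i j => fderiv ℝ (fderiv ℝ (fun q => a q i j)) (Γ z) e e)
    (fun i j => spaceDeriv (b i) (spaceDeriv (b j) W) z)
    (fun i j => spaceDeriv e (spaceDeriv (b i) (spaceDeriv (b j) W)) z)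
    (fun i j => spaceDeriv e (spaceDeriv e (spaceDeriv (b i) (spaceDeriv (b j) W))) z)
    (fun i j => inner ℝ (b i) (b j)) (d := d) (μ := μ) hrpos.ne' hode hc
  have hb : ∀ {β : ℝ → ℝ} {g : ℝ}, ContDiffOn ℝ ∞ β (Set.Ioi 0) → ConvexOn ℝ (Set.Ioi 0) β →
      0 ≤ g → 0 ≤ deriv (deriv β) (W z) * d ^ 2 * g := fun hβ hβc hg =>
    mul_nonneg (mul_nonneg (hβc.deriv_deriv_nonneg_of_isOpen isOpen_Ioi
      (hβ.of_le ENat.LEInfty.out) hWpos) (sq_nonneg d)) hg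
  have hg₁ := hb hb₁_smooth hb₁_convex (g := ‖Γ z‖ ^ p) (by positivity)
  have hg₂ := hb hb₂_smooth hb₂_convex (g := ‖Γ z‖ ^ 2) (by positivity)
  have hg₃ := hb hb₃_smooth hb₃_convex (g := 1) zero_le_one
  have hmain := mul_nonneg hrpos.le htr
  have hΓz : spaceGrad w z.1 z.2 = Γ z := rfl
  rw [hcomm, hval]
  simp only [touchingRemainder, ← hWz, ← hWw, hΓz]
  simp only [map_smul, map_zero, smul_apply, smul_eq_mul, add_zero]
  have hquad : ∀ x : ℝ, -μ * (-μ * x) = μ ^ 2 * x := fun x => by ring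
  simp only [hquad]
  -- `P` is the nonnegative trace term, the `g`s are the `b''` terms; dropping them leaves only the
  -- terms of order `μ`.
  have key : ∀ {P Y S L₁ L₂ L₃ g₁ g₂ g₃ : ℝ}, Y = P + μ * S → 0 ≤ P → 0 ≤ g₁ → 0 ≤ g₂ → 0 ≤ g₃ →
      μ * (S + L₁ + L₂ + L₃) ≤ Y + (g₁ + μ * L₁) + (g₂ + μ * L₂) + (g₃ + μ * L₃) := by
    intros
    linarith
  exact key hid hmain hg₁ hg₂ hg₃

end Touching

theorem ContinuousOn.lowerOrderRemainder {X E : Type*} [TopologicalSpace X] [NormedAddCommGroup E]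
    [NormedSpace ℝ E] {b : ℝ → ℝ} {G : E → ℝ} (hb : ContDiffOn ℝ ∞ b (Set.Ioi 0))
    (hG : ContDiff ℝ 2 G) {u d μ : X → ℝ} {q e : X → E} {s : Set X} (hu : ContinuousOn u s)
    (hd : ContinuousOn d s) (hμ : ContinuousOn μ s) (hq : ContinuousOn q s)
    (he : ContinuousOn e s) (hpos : ∀ x ∈ s, 0 < u x) :
    ContinuousOn (fun x => _root_.lowerOrderRemainder b G (u x) (d x) (q x) (e x) (μ x)) s := by
  have h1 : ContinuousOn (fun x => b (u x)) s := hb.continuousOn.comp hu hpos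
  have h2 : ContinuousOn (fun x => deriv b (u x)) s :=
    (hb.continuousOn_deriv_of_isOpen isOpen_Ioi (by simp)).comp hu hpos
  have h3 : ContinuousOn (fun x => G (q x)) s := hG.continuous.comp_continuousOn hq
  have h4 : ContinuousOn (fun x => fderiv ℝ G (q x) (e x)) s :=
    ((hG.continuous_fderiv (by simp)).comp_continuousOn hq).clm_apply he
  have hG' : ContDiff ℝ 1 (fderiv ℝ G) := hG.fderiv_right (by norm_num)
  have h5 : ContinuousOn (fun x => fderiv ℝ (fderiv ℝ G) (q x) (e x) (e x)) s :=
    (((hG'.continuous_fderiv (by simp)).comp_continuousOn hq).clm_apply he).clm_apply he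
  exact ((h2.mul h3).neg.sub (continuousOn_const.mul ((h2.mul hd).mul h4))).add
    (h1.mul (hμ.mul h5))

/-! ### Bounding the remainder; conditions at a touching point -/

section Touching

variable {n : ℕ} {Ω : Set (EuclideanSpace ℝ (Fin n))} {w : EuclideanSpace ℝ (Fin n) → ℝ → ℝ}

local notation "𝔼" => EuclideanSpace ℝ (Fin n)

/-- Treating `e` and `μ` as variables gives one bound on a compact set, valid for all `ε` at once.
The remainder contains third derivatives of `w`, so continuity is claimed only over the open
cylinder. -/
theorem continuousOn_touchingRemainder (hΩ : IsOpen Ω)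
    {p : ℝ} (hp : 2 ≤ p) {a : 𝔼 → Matrix (Fin n) (Fin n) ℝ}
    (ha_smooth : ∀ i j, ContDiff ℝ ∞ (fun q => a q i j))
    {ρ b₁ b₂ b₃ : ℝ → ℝ} (hρ_smooth : ContDiff ℝ ∞ ρ)
    (hb₁_smooth : ContDiffOn ℝ ∞ b₁ (Set.Ioi 0)) (hb₂_smooth : ContDiffOn ℝ ∞ b₂ (Set.Ioi 0))
    (hb₃_smooth : ContDiffOn ℝ ∞ b₃ (Set.Ioi 0))
    (hW : ContDiffOn ℝ ∞ (fun z : 𝔼 × ℝ => w z.1 z.2) (Ω ×ˢ Set.Ioi 0))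
    (hpos : ∀ z ∈ Ω ×ˢ Set.Ioi (0 : ℝ), 0 < w z.1 z.2) :
    ContinuousOn (fun y : ((𝔼 × ℝ) × 𝔼) × ℝ =>
        touchingRemainder p a ρ b₁ b₂ b₃ w y.1.1 y.1.2 y.2)
      (((Ω ×ˢ Set.Ioi (0 : ℝ)) ×ˢ Set.univ) ×ˢ Set.univ) := by
  have hU : IsOpen (Ω ×ˢ Set.Ioi (0 : ℝ)) := isOpen_cylinder hΩ
  set D : Set (((𝔼 × ℝ) × 𝔼) × ℝ) := ((Ω ×ˢ Set.Ioi (0 : ℝ)) ×ˢ Set.univ) ×ˢ Set.univ with hD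
  have hmaps : Set.MapsTo (fun y : ((𝔼 × ℝ) × 𝔼) × ℝ => y.1.1) D (Ω ×ˢ Set.Ioi (0 : ℝ)) :=
    fun y hy => hy.1.1
  have hz : ContinuousOn (fun y : ((𝔼 × ℝ) × 𝔼) × ℝ => y.1.1) D := by fun_prop
  have he : ContinuousOn (fun y : ((𝔼 × ℝ) × 𝔼) × ℝ => y.1.2) D := by fun_prop
  have hμ : ContinuousOn (fun y : ((𝔼 × ℝ) × 𝔼) × ℝ => y.2) D := by fun_prop
  have hη : ContinuousOn (fun y : ((𝔼 × ℝ) × 𝔼) × ℝ => (y.1.2, (0 : ℝ))) D := by fun_prop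
  have hu : ContinuousOn (fun y : ((𝔼 × ℝ) × 𝔼) × ℝ => w y.1.1.1 y.1.1.2) D :=
    hW.continuousOn.comp hz hmaps
  have hup : ∀ y ∈ D, 0 < w y.1.1.1 y.1.1.2 := fun y hy => hpos _ (hmaps hy)
  have hq : ContinuousOn (fun y : ((𝔼 × ℝ) × 𝔼) × ℝ => spaceGrad w y.1.1.1 y.1.1.2) D :=
    (contDiffOn_spaceGrad hΩ hW).continuousOn.comp hz hmaps
  have hdir : ∀ {f : 𝔼 × ℝ → ℝ}, ContDiffOn ℝ ∞ f (Ω ×ˢ Set.Ioi (0 : ℝ)) →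
      ContinuousOn (fun y : ((𝔼 × ℝ) × 𝔼) × ℝ => spaceDeriv y.1.2 f y.1.1) D := fun hf =>
    ((hf.fderiv_of_isOpen_infty hU).continuousOn.comp hz hmaps).clm_apply hη
  have hd := hdir hW
  have hh : ∀ i j : Fin n, ContDiffOn ℝ ∞ (spaceDeriv (EuclideanSpace.single i 1)
      (spaceDeriv (EuclideanSpace.single j 1) fun z : 𝔼 × ℝ => w z.1 z.2))
      (Ω ×ˢ Set.Ioi (0 : ℝ)) := fun i j => (hW.dirDeriv hU _).dirDeriv hU _
  have hh0 := fun i j => (hh i j).continuousOn.comp hz hmaps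
  have hh1 := fun i j => hdir (hh i j)
  have hρ0 : ContinuousOn (fun y : ((𝔼 × ℝ) × 𝔼) × ℝ => ρ (w y.1.1.1 y.1.1.2)) D :=
    hρ_smooth.continuous.comp_continuousOn hu
  have hρ' : ContDiff ℝ ∞ (deriv ρ) := by
    have := hρ_smooth.iterate_deriv 1
    simpa using this
  have hρ1 : ContinuousOn (fun y : ((𝔼 × ℝ) × 𝔼) × ℝ => deriv ρ (w y.1.1.1 y.1.1.2)) D :=
    hρ'.continuous.comp_continuousOn hu
  have hρ2 : ContinuousOn (fun y : ((𝔼 × ℝ) × 𝔼) × ℝ =>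
      deriv (deriv ρ) (w y.1.1.1 y.1.1.2)) D :=
    (hρ'.continuous_deriv (by simp)).comp_continuousOn hu
  have ha0 := fun i j => (ha_smooth i j).continuous.comp_continuousOn hq
  have ha1 := fun i j =>
    (((ha_smooth i j).continuous_fderiv (by simp)).comp_continuousOn hq).clm_apply he
  have ha2 := fun i j =>
    (((((ha_smooth i j).fderiv_right (m := ∞) (by simp)).continuous_fderiv
      (by simp)).comp_continuousOn hq).clm_apply he).clm_apply he
  have hl1 := ContinuousOn.lowerOrderRemainder hb₁_smooth (contDiff_two_norm_rpow hp) hu hd hμ hq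
    he hup
  have hl2 := ContinuousOn.lowerOrderRemainder hb₂_smooth
    (G := fun q : 𝔼 => ‖q‖ ^ 2) (contDiff_norm_sq ℝ) hu hd hμ hq he hup
  have hl3 := ContinuousOn.lowerOrderRemainder hb₃_smooth
    (G := fun _ : 𝔼 => (1 : ℝ)) contDiff_const hu hd hμ hq he hup
  simp only [Function.comp_def] at hh0 ha0 ha1 ha2
  unfold touchingRemainder
  refine ContinuousOn.add (.add (.add ?_ hl1) hl2) hl3
  refine continuousOn_finsetSum _ fun i _ => continuousOn_finsetSum _ fun j _ => ?_
  have k0 := hh0 i j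
  have k1 := hh1 i j
  have k2 := ha0 i j
  have k3 := ha1 i j
  have k4 := ha2 i j
  have k5 : ContinuousOn (fun _ : ((𝔼 × ℝ) × 𝔼) × ℝ =>
    (inner ℝ (EuclideanSpace.single i (1 : ℝ)) (EuclideanSpace.single j (1 : ℝ)) : ℝ)) D :=
    continuousOn_const
  exact ((((hρ1.mul k2).mul k0).neg.sub (continuousOn_const.mul (((hρ1.mul hd).mul k3).mul k0))).add
    (hρ0.mul (((hμ.mul k4).mul k0).sub (continuousOn_const.mul (k3.mul k1))))).sub
    ((((hρ2.mul (hd.pow 2)).mul k2).mul k5))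

theorem spaceDeriv_add_smul {W : 𝔼 × ℝ → ℝ} {U : Set (𝔼 × ℝ)} (hU : IsOpen U)
    (hW : ContDiffOn ℝ ∞ W U) (u v : 𝔼) (c : ℝ) {z : 𝔼 × ℝ} (hz : z ∈ U) :
    spaceDeriv (u + c • v) (spaceDeriv (u + c • v) W) z = spaceDeriv u (spaceDeriv u W) z
      + 2 * c * spaceDeriv u (spaceDeriv v W) z + c ^ 2 * spaceDeriv v (spaceDeriv v W) z := by
  have e : ((u + c • v, (0 : ℝ)) : 𝔼 × ℝ) = (u, 0) + c • (v, 0) := by ext <;> simp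
  have hs := hW.dirDeriv_comm hU hz (u, (0 : ℝ)) (v, 0)
  simp only [spaceDeriv, hW.dirDeriv_dirDeriv hU hz, e] at hs ⊢
  simp only [map_add, map_smul, add_apply, smul_apply, smul_eq_mul]
  rw [← hs]
  ring

variable {W : EuclideanSpace ℝ (Fin n) × ℝ → ℝ} {U : Set (EuclideanSpace ℝ (Fin n) × ℝ)}

/-- The kernel of the nonnegative form `D²w + μ`. -/
theorem spaceDeriv_eq_of_touching (hU : IsOpen U)
    (hW : ContDiffOn ℝ ∞ W U) {z : 𝔼 × ℝ} (hz : z ∈ U) {μ : ℝ} {e : 𝔼}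
    (hnn : ∀ v, 0 ≤ spaceDeriv v (spaceDeriv v W) z + μ * ‖v‖ ^ 2)
    (h0 : spaceDeriv e (spaceDeriv e W) z + μ * ‖e‖ ^ 2 = 0) (v : 𝔼) :
    spaceDeriv e (spaceDeriv v W) z = -μ * inner ℝ e v := by
  -- The form at `e + s • v` is a quadratic in `s` with constant term zero by `h0`; being
  -- nonnegative, it has no linear term.
  have h : ∀ s : ℝ, 0 ≤ (spaceDeriv v (spaceDeriv v W) z + μ * ‖v‖ ^ 2) * (s * s)
      + 2 * (spaceDeriv e (spaceDeriv v W) z + μ * inner ℝ e v) * s + 0 := fun s => by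
    have h1 := hnn (e + s • v)
    rw [spaceDeriv_add_smul hU hW e v s hz, norm_add_sq_real, real_inner_smul_right,
      norm_smul, mul_pow, Real.norm_eq_abs, sq_abs] at h1
    linarith
  have hd := discrim_le_zero h
  rw [discrim] at hd
  have : (2 * (spaceDeriv e (spaceDeriv v W) z + μ * inner ℝ e v)) ^ 2 = 0 :=
    le_antisymm (by linarith) (sq_nonneg _)
  have := pow_eq_zero_iff (two_ne_zero) |>.1 this
  linarith

/-- First and second order conditions where `D²w + μ` touches zero from above. -/
theorem spaceDeriv_conditions_of_touching (hU : IsOpen U)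
    (hW : ContDiffOn ℝ ∞ W U) {z : 𝔼 × ℝ} (hz : z ∈ U) {μ : ℝ} {e : 𝔼}
    (hnn : ∀ y ∈ U, y.2 = z.2 → ∀ v, 0 ≤ spaceDeriv v (spaceDeriv v W) y + μ * ‖v‖ ^ 2)
    (h0 : spaceDeriv e (spaceDeriv e W) z + μ * ‖e‖ ^ 2 = 0) (c : ℝ) (v : 𝔼) :
    spaceDeriv v (spaceDeriv e (spaceDeriv e W)) z
        + 2 * c * (spaceDeriv e (spaceDeriv v W) z + μ * inner ℝ e v) = 0 ∧
      0 ≤ spaceDeriv e (spaceDeriv e (spaceDeriv v (spaceDeriv v W))) z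
        + 4 * c * spaceDeriv e (spaceDeriv v (spaceDeriv v W)) z
        + 2 * c ^ 2 * spaceDeriv v (spaceDeriv v W) z + 2 * c ^ 2 * μ * ‖v‖ ^ 2 := by
  have hP := ((hW.dirDeriv hU (e, (0 : ℝ))).dirDeriv hU (e, (0 : ℝ))).hasTwoJet_line hU hz
    (v, (0 : ℝ))
  have hQ := ((hW.dirDeriv hU (v, (0 : ℝ))).dirDeriv hU (e, (0 : ℝ))).hasTwoJet_line hU hz
    (v, (0 : ℝ))
  have hR := ((hW.dirDeriv hU (v, (0 : ℝ))).dirDeriv hU (v, (0 : ℝ))).hasTwoJet_line hU hz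
    (v, (0 : ℝ))
  have hs : HasTwoJet (fun s : ℝ => s) 0 1 0 :=
    ⟨rfl, fun _ => 1, rfl, .of_forall fun s => hasDerivAt_id s, hasDerivAt_const 0 1⟩
  -- Jet of `s ↦ (D²w + μ)(e + s c v, e + s c v)` along `z + s v`, expanded by bilinearity. No
  -- normalization of the moving vector is needed, since `hnn` covers all lengths.
  have hJ := ((hP.add ((HasTwoJet.const (2 * c)).mul (hs.mul hQ))).add
    ((HasTwoJet.const (c ^ 2)).mul ((hs.mul hs).mul hR))).add
    (((HasTwoJet.const (μ * ‖e‖ ^ 2)).add ((HasTwoJet.const (2 * c * μ * inner ℝ e v)).mul hs)).add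
      ((HasTwoJet.const (c ^ 2 * μ * ‖v‖ ^ 2)).mul (hs.mul hs)))
  have hmin := hJ.eq_zero_and_nonneg_of_isLocalMin (by
    filter_upwards [eventually_line_mem hU hz (v, (0 : ℝ))] with s hsU
    have h1 := hnn _ hsU (by simp) (e + (s * c) • v)
    have hnorm : ‖(s * c) • v‖ ^ 2 = (s * c) ^ 2 * ‖v‖ ^ 2 := by
      rw [norm_smul, mul_pow, Real.norm_eq_abs, sq_abs]
    rw [spaceDeriv_add_smul hU hW e v (s * c) hsU, norm_add_sq_real, real_inner_smul_right,
      hnorm] at h1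
    simp only [zero_smul, add_zero, zero_mul, mul_zero]
    simp only [spaceDeriv] at h1 h0 ⊢
    rw [h0]
    linarith)
  -- Reorders `w_{vvee}` into `w_{eevv}` and `w_{vev}` into `w_{evv}`.
  have hc1 := hW.dirDeriv_pair_comm hU hz (e, (0 : ℝ)) (v, (0 : ℝ))
  have hc2 := (hW.dirDeriv hU (v, (0 : ℝ))).dirDeriv_comm hU hz (v, (0 : ℝ)) (e, (0 : ℝ))
  obtain ⟨hm1, hm2⟩ := hmin
  rw [hc1, hc2] at hm2
  simp only [spaceDeriv] at h0 ⊢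
  constructor <;> linarith

/-- Difference quotients from the left are nonpositive. A first touching gives information about
earlier times only. -/
theorem deriv_nonpos_of_nonneg_left {φ : ℝ → ℝ} {φ' t : ℝ} (h : HasDerivAt φ φ' t) (h0 : φ t = 0)
    (hl : ∀ᶠ s in 𝓝[<] t, 0 ≤ φ s) : φ' ≤ 0 := by
  have h1 : Tendsto (slope φ t) (𝓝[<] t) (𝓝 φ') :=
    (hasDerivAt_iff_tendsto_slope.1 h).mono_left (nhdsWithin_mono _ fun s hs => ne_of_lt hs)
  refine le_of_tendsto h1 ?_
  filter_upwards [hl, self_mem_nhdsWithin] with s hs hst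
  rw [slope_def_field, h0, sub_zero]
  exact div_nonpos_of_nonneg_of_nonpos hs (sub_nonpos.2 (le_of_lt hst))

end Touching

/-! ### Joint continuity of the Hessian and the first touching time -/

section MaximumPrinciple

variable {n : ℕ} {Ω : Set (EuclideanSpace ℝ (Fin n))} {w : EuclideanSpace ℝ (Fin n) → ℝ → ℝ}

local notation "𝔼" => EuclideanSpace ℝ (Fin n)

theorem spaceHess_eq_fderivWithin (hu : UniqueDiffOn ℝ (closure Ω)) {x : 𝔼} (hx : x ∈ closure Ω)
    (t : ℝ) (u v : 𝔼) : spaceHess Ω w x t u v =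
      fderivWithin ℝ (fderivWithin ℝ (fun y => w y t) (closure Ω)) (closure Ω) x u v := by
  rw [spaceHess, iteratedFDerivWithin_two_apply _ hu hx]
  rfl

theorem spaceHess_smul_smul (hu : UniqueDiffOn ℝ (closure Ω)) {x : 𝔼} (hx : x ∈ closure Ω)
    (t c : ℝ) (v : 𝔼) :
    spaceHess Ω w x t (c • v) (c • v) = c ^ 2 * spaceHess Ω w x t v v := by
  simp only [spaceHess_eq_fderivWithin hu hx, map_smul, smul_apply, smul_eq_mul]
  ring

/-- The Hessian as a function of position, time and direction is continuous on the closed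
cylinder. -/
theorem continuousOn_spaceHess_diag (hu : UniqueDiffOn ℝ (closure Ω))
    (hc : ∀ u v : 𝔼, ContinuousOn (fun z : 𝔼 × ℝ => spaceHess Ω w z.1 z.2 u v)
      (closure Ω ×ˢ Set.Ici 0)) :
    ContinuousOn (fun y : (𝔼 × ℝ) × 𝔼 => spaceHess Ω w y.1.1 y.1.2 y.2 y.2)
      ((closure Ω ×ˢ Set.Ici 0) ×ˢ Set.univ) := by
  -- Continuity is given for each fixed pair of directions; expanding in the basis makes it joint in
  -- the direction.
  have hsum : ∀ y ∈ (closure Ω ×ˢ Set.Ici (0 : ℝ)) ×ˢ (Set.univ : Set 𝔼),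
      spaceHess Ω w y.1.1 y.1.2 y.2 y.2 = ∑ i, ∑ j, y.2 i * (y.2 j *
        spaceHess Ω w y.1.1 y.1.2 (EuclideanSpace.single i 1) (EuclideanSpace.single j 1)) := by
    intro y hy
    have he : y.2 = ∑ i, y.2 i • EuclideanSpace.single i (1 : ℝ) := by
      have := (EuclideanSpace.basisFun (Fin n) ℝ).sum_repr y.2
      simpa using this.symm
    simp only [spaceHess_eq_fderivWithin hu hy.1.1]
    conv_lhs => rw [he]
    simp only [map_sum, map_smul, sum_apply, smul_apply, smul_eq_mul, Finset.mul_sum]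
    rw [Finset.sum_comm]
    exact Finset.sum_congr rfl fun i _ => Finset.sum_congr rfl fun j _ => by ring
  refine ContinuousOn.congr ?_ hsum
  refine continuousOn_finsetSum _ fun i _ => continuousOn_finsetSum _ fun j _ => ?_
  have h1 : ContinuousOn (fun y : (𝔼 × ℝ) × 𝔼 => spaceHess Ω w y.1.1 y.1.2
      (EuclideanSpace.single i 1) (EuclideanSpace.single j 1))
      ((closure Ω ×ˢ Set.Ici 0) ×ˢ Set.univ) :=
    (hc _ _).comp (f := fun y : (𝔼 × ℝ) × 𝔼 => y.1) (by fun_prop) fun y hy => hy.1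
  have h2 : ∀ k : Fin n, ContinuousOn (fun y : (𝔼 × ℝ) × 𝔼 => y.2 k)
      ((closure Ω ×ˢ Set.Ici 0) ×ˢ Set.univ) := fun k => by fun_prop
  exact (h2 i).mul ((h2 j).mul h1)

/-- A function on a compact cylinder that is positive initially but not everywhere touches zero at
a first time. -/
theorem exists_first_touching {E : Type*} [TopologicalSpace E] [T2Space E] {C S : Set E} {T : ℝ}
    (hC : IsCompact C) (hS : IsCompact S) {F : (E × ℝ) × E → ℝ}
    (hF : ContinuousOn F ((C ×ˢ Set.Icc 0 T) ×ˢ S))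
    (h0 : ∀ x ∈ C, ∀ e ∈ S, 0 < F ((x, 0), e))
    (hne : ∃ y ∈ (C ×ˢ Set.Icc 0 T) ×ˢ S, F y ≤ 0) :
    ∃ x₀ ∈ C, ∃ t₀ ∈ Set.Ioc 0 T, ∃ e₀ ∈ S, F ((x₀, t₀), e₀) = 0 ∧
      ∀ t ∈ Set.Icc 0 t₀, ∀ x ∈ C, ∀ e ∈ S, 0 ≤ F ((x, t), e) := by
  have hX : IsCompact ((C ×ˢ Set.Icc 0 T) ×ˢ S) := (hC.prod isCompact_Icc).prod hS
  have hB : IsCompact (((C ×ˢ Set.Icc 0 T) ×ˢ S) ∩ F ⁻¹' Set.Iic 0) :=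
    hX.of_isClosed_subset (hF.preimage_isClosed_of_isClosed hX.isClosed isClosed_Iic)
      Set.inter_subset_left
  obtain ⟨y₁, hy₁, hy₁'⟩ := hne
  obtain ⟨⟨⟨x₀, t₀⟩, e₀⟩, ⟨⟨⟨hx₀, ht₀⟩, he₀⟩, hF₀⟩, hmin⟩ :=
    -- Minimize the time coordinate over the compact set `{F ≤ 0}`.
    hB.exists_isMinOn ⟨y₁, hy₁, hy₁'⟩
      (f := fun y : (E × ℝ) × E => y.1.2) (by fun_prop)
  simp only [Set.mem_preimage, Set.mem_Iic] at hx₀ ht₀ he₀ hF₀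
  have ht₀pos : 0 < t₀ := by
    refine lt_of_le_of_ne ht₀.1 fun h => ?_
    subst h
    exact absurd hF₀ (not_le.2 (h0 x₀ hx₀ e₀ he₀))
  have hlt : ∀ t ∈ Set.Ico 0 t₀, ∀ x ∈ C, ∀ e ∈ S, 0 ≤ F ((x, t), e) := by
    intro t ht x hx e he
    by_contra! hneg
    have := hmin (show ((x, t), e) ∈ ((C ×ˢ Set.Icc 0 T) ×ˢ S) ∩ F ⁻¹' Set.Iic 0 from
      ⟨⟨⟨hx, ht.1, ht.2.le.trans ht₀.2⟩, he⟩, hneg.le⟩)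
    exact absurd ht.2 (not_lt.2 this)
  -- Nonnegativity before `t₀` passes to `t₀` by continuity in time.
  have hle : ∀ t ∈ Set.Icc 0 t₀, ∀ x ∈ C, ∀ e ∈ S, 0 ≤ F ((x, t), e) := by
    intro t ht x hx e he
    have hcl : closure (Set.Ico 0 t₀) = Set.Icc 0 t₀ := closure_Ico ht₀pos.ne
    refine le_on_closure (f := fun _ => (0 : ℝ)) (g := fun t => F ((x, t), e))
      (s := Set.Ico 0 t₀) (fun s hs => hlt s hs x hx e he) continuousOn_const ?_ (hcl ▸ ht)
    rw [hcl]
    exact hF.comp (f := fun t : ℝ => ((x, t), e)) (by fun_prop) fun s hs =>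
      ⟨⟨hx, hs.1, hs.2.trans ht₀.2⟩, he⟩
  exact ⟨x₀, hx₀, t₀, ⟨ht₀pos, ht₀.2⟩, e₀, he₀,
    le_antisymm hF₀ (hle t₀ ⟨ht₀pos.le, le_rfl⟩ x₀ hx₀ e₀ he₀), hle⟩

end MaximumPrinciple

/-! ### The convexity theorem -/

theorem lemma2p1 {n : ℕ} (Ω : Set (EuclideanSpace ℝ (Fin n)))
    (hΩ : IsStrictlyConvexSmoothDomain Ω)
    (p : ℝ) (hp : 2 ≤ p)
    (a : EuclideanSpace ℝ (Fin n) → Matrix (Fin n) (Fin n) ℝ)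
    (ha_smooth : ∀ i j, ContDiff ℝ ∞ (fun q => a q i j))
    (ha_elliptic : ∃ c₀ : ℝ, 0 < c₀ ∧ ∀ q ξ : EuclideanSpace ℝ (Fin n),
      c₀ * ‖ξ‖ ^ 2 ≤ ∑ i, ∑ j, a q i j * ξ i * ξ j)
    (ρ b₁ b₂ b₃ : ℝ → ℝ)
    (hρ_smooth : ContDiff ℝ ∞ ρ)
    (hρ_pos : ∀ s : ℝ, s ≠ 0 → 0 < ρ s)
    (hρ_ode : ∀ s : ℝ, s ≠ 0 → deriv (deriv ρ) s - (deriv ρ s) ^ 2 / (2 * ρ s) = 0)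
    (hb₁_smooth : ContDiffOn ℝ ∞ b₁ (Set.Ioi 0)) (hb₁_convex : ConvexOn ℝ (Set.Ioi 0) b₁)
    (hb₂_smooth : ContDiffOn ℝ ∞ b₂ (Set.Ioi 0)) (hb₂_convex : ConvexOn ℝ (Set.Ioi 0) b₂)
    (hb₃_smooth : ContDiffOn ℝ ∞ b₃ (Set.Ioi 0)) (hb₃_convex : ConvexOn ℝ (Set.Ioi 0) b₃)
    (w : EuclideanSpace ℝ (Fin n) → ℝ → ℝ)
    (hw_smooth : IsSmoothOnCylinder Ω w)
    (hw_pos : ∀ x ∈ Ω, ∀ t : ℝ, 0 < t → 0 < w x t)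
    (hw_eq : SolvesEquation Ω p a ρ b₁ b₂ b₃ w)
    (h_lateral : ∃ δ : ℝ, 0 < δ ∧ ∀ x ∈ frontier Ω, ∀ t : ℝ, 0 ≤ t →
      ∀ e : EuclideanSpace ℝ (Fin n), ‖e‖ = 1 → δ ≤ spaceHess Ω w x t e e)
    (h_initial : ∃ δ : ℝ, 0 < δ ∧ ∀ x ∈ Ω,
      ∀ e : EuclideanSpace ℝ (Fin n), ‖e‖ = 1 → δ ≤ spaceHess Ω w x 0 e e) :
    (∀ x ∈ Ω, ∀ t : ℝ, 0 ≤ t →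
      ∀ e : EuclideanSpace ℝ (Fin n), ‖e‖ = 1 → 0 ≤ spaceHess Ω w x t e e) ∧
    (∀ t : ℝ, 0 ≤ t → ConvexOn ℝ Ω (fun x => w x t)) := by
  obtain ⟨c₀, hc₀, hell⟩ := ha_elliptic
  obtain ⟨δ, hδ, hlat⟩ := h_lateral
  obtain ⟨δ', hδ', hini⟩ := h_initial
  have ha : ∀ q ξ : EuclideanSpace ℝ (Fin n), 0 ≤ ∑ i, ∑ j, a q i j * ξ i * ξ j :=
    fun q ξ => le_trans (by positivity) (hell q ξ)
  have hO := hΩ.isOpen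
  have hud : UniqueDiffOn ℝ (closure Ω) := by
    refine uniqueDiffOn_convex hΩ.convex.closure (hΩ.nonempty.mono ?_)
    exact interior_maximal subset_closure hO
  have hcont := continuousOn_spaceHess_diag hud hw_smooth.continuousOn_hess
  have hcpt : IsCompact (closure Ω) := hΩ.isBounded.isCompact_closure
  have hsph : IsCompact (Metric.sphere (0 : EuclideanSpace ℝ (Fin n)) 1) := isCompact_sphere 0 1
  set W : EuclideanSpace ℝ (Fin n) × ℝ → ℝ := fun z => w z.1 z.2 with hWdef
  have hW : ContDiffOn ℝ ∞ W (Ω ×ˢ Set.Ioi 0) := hw_smooth.smooth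
  have hU := isOpen_cylinder hO
  have hHW : ∀ z ∈ Ω ×ˢ Set.Ioi (0 : ℝ), ∀ v, spaceHess Ω w z.1 z.2 v v =
      spaceDeriv v (spaceDeriv v W) z := fun z hz v => spaceHess_eq_spaceDeriv hO hW hz v v
  have hini' : ∀ x ∈ closure Ω, ∀ e : EuclideanSpace ℝ (Fin n), ‖e‖ = 1 →
      δ' ≤ spaceHess Ω w x 0 e e := fun x hx e he =>
    le_on_closure (f := fun _ => δ') (g := fun x => spaceHess Ω w x 0 e e)
      (fun y hy => hini y hy e he) continuousOn_const
      ((hw_smooth.continuousOn_hess e e).comp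
        (f := fun x : EuclideanSpace ℝ (Fin n) => (x, (0 : ℝ))) (by fun_prop)
        fun y hy => ⟨hy, Set.self_mem_Ici⟩) hx
  have hint : ∀ x ∈ closure Ω, x ∉ frontier Ω → x ∈ Ω := fun x hx hxf => by
    by_contra h
    exact hxf ⟨hx, by rwa [hO.interior_eq]⟩
  have hmain : ∀ T : ℝ, 0 ≤ T → ∀ x ∈ Ω, ∀ e : EuclideanSpace ℝ (Fin n), ‖e‖ = 1 →
      0 ≤ spaceHess Ω w x T e e := by
    intro T hT x hx e he
    set S := Metric.sphere (0 : EuclideanSpace ℝ (Fin n)) 1 with hS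
    set X := (closure Ω ×ˢ Set.Icc 0 T) ×ˢ S with hXdef
    have hX : IsCompact X := (hcpt.prod isCompact_Icc).prod hsph
    have hFX : ContinuousOn (fun y : (EuclideanSpace ℝ (Fin n) × ℝ) × EuclideanSpace ℝ (Fin n) =>
        spaceHess Ω w y.1.1 y.1.2 y.2 y.2) X :=
      hcont.mono fun y hy => ⟨⟨hy.1.1, hy.1.2.1⟩, Set.mem_univ _⟩
    -- Every touching point lies in `Z`, since `D²w(e,e) = -μ < 0` there. `Z` does not depend on `ε`
    -- and stays off the lateral and initial boundary.
    set Z := X ∩ (fun y : (EuclideanSpace ℝ (Fin n) × ℝ) × EuclideanSpace ℝ (Fin n) =>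
        spaceHess Ω w y.1.1 y.1.2 y.2 y.2) ⁻¹' Set.Iic 0 with hZdef
    have hZ : IsCompact Z :=
      hX.of_isClosed_subset (hFX.preimage_isClosed_of_isClosed hX.isClosed isClosed_Iic)
        Set.inter_subset_left
    have hZU : ∀ y ∈ Z, y.1 ∈ Ω ×ˢ Set.Ioi (0 : ℝ) := by
      rintro ⟨⟨y, t⟩, f⟩ ⟨⟨⟨hy, ht⟩, hf⟩, hneg⟩
      simp only [Set.mem_preimage, Set.mem_Iic] at hneg hy ht hf
      have hf1 : ‖f‖ = 1 := by simpa [hS] using hf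
      refine ⟨hint y hy fun hyf => ?_, lt_of_le_of_ne ht.1 fun h0 => ?_⟩
      · linarith [hlat y hyf t ht.1 f hf1]
      · subst h0
        linarith [hini' y hy f hf1]
    have hRc := continuousOn_touchingRemainder hO hp ha_smooth hρ_smooth hb₁_smooth hb₂_smooth
      hb₃_smooth hW fun z hz => hw_pos z.1 hz.1 z.2 hz.2
    -- The factor `[0, 1]` is the range of `μ`, ensured below by `ε * exp (K * T) ≤ 1`.
    obtain ⟨M, hM⟩ := (hZ.prod (isCompact_Icc (a := (0 : ℝ)) (b := 1))).exists_bound_of_continuousOn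
      (hRc.mono fun y hy => ⟨⟨hZU _ hy.1, Set.mem_univ _⟩, Set.mem_univ _⟩)
    set K := |M| + 1 with hK
    have key : ∀ ε : ℝ, 0 < ε → ε * Real.exp (K * T) ≤ 1 → ∀ y ∈ X,
        0 < spaceHess Ω w y.1.1 y.1.2 y.2 y.2 + ε * Real.exp (K * y.1.2) := by
      intro ε hε hε1
      by_contra! hcon
      obtain ⟨x₀, hx₀, t₀, ht₀, e₀, he₀, hzero, hnn⟩ := exists_first_touching hcpt hsph
        (F := fun y => spaceHess Ω w y.1.1 y.1.2 y.2 y.2 + ε * Real.exp (K * y.1.2))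
        (hFX.add (by fun_prop))
        (fun x hx e he => by
          have := hini' x hx e (mem_sphere_zero_iff_norm.1 he)
          have : 0 < ε * Real.exp (K * 0) := by positivity
          simp only
          linarith) hcon
      simp only at hzero hnn
      set μ := ε * Real.exp (K * t₀) with hμ
      have hμpos : 0 < μ := by positivity
      have hμ1 : μ ≤ 1 := le_trans (by rw [hμ]; gcongr; exact ht₀.2) hε1
      have he₀1 : ‖e₀‖ = 1 := mem_sphere_zero_iff_norm.1 he₀
      have hyZ : ((x₀, t₀), e₀) ∈ Z :=
        ⟨⟨⟨hx₀, ht₀.1.le, ht₀.2⟩, he₀⟩, by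
          simp only [Set.mem_preimage, Set.mem_Iic]; linarith⟩
      have hz := hZU _ hyZ
      simp only at hz
      have hnnv : ∀ y ∈ Ω ×ˢ Set.Ioi (0 : ℝ), y.2 = t₀ → ∀ v,
          0 ≤ spaceDeriv v (spaceDeriv v W) y + μ * ‖v‖ ^ 2 := by
        rintro ⟨y, t⟩ hy rfl v
        rw [← hHW _ hy]
        simp only
        rcases eq_or_ne v 0 with rfl | hv
        · simp [spaceHess_eq_fderiv_fderiv hO hy.1]
        · have hvn : ‖v‖ ≠ 0 := norm_ne_zero_iff.2 hv
          have h1 := hnn t ⟨ht₀.1.le, le_rfl⟩ y (subset_closure hy.1) (‖v‖⁻¹ • v)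
            (mem_sphere_zero_iff_norm.2 (by simp [norm_smul, hvn]))
          rw [spaceHess_smul_smul hud (subset_closure hy.1)] at h1
          have h2 := mul_nonneg (sq_nonneg ‖v‖) h1
          have h3 : ‖v‖ ^ 2 * (‖v‖⁻¹ ^ 2 * spaceHess Ω w y t v v + μ) =
              spaceHess Ω w y t v v + μ * ‖v‖ ^ 2 := by field_simp
          rwa [h3] at h2
      have hz0 : spaceDeriv e₀ (spaceDeriv e₀ W) (x₀, t₀) + μ * ‖e₀‖ ^ 2 = 0 := by
        rw [← hHW _ hz, he₀1]
        simpa using hzero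
      have hnull := spaceDeriv_eq_of_touching hU hW hz (fun v => hnnv _ hz rfl v) hz0
      have hcond := spaceDeriv_conditions_of_touching hU hW hz (fun y hy h => hnnv y hy h) hz0
      -- A fixed direction, `c = 0`, suffices for the first order condition.
      have hcrit : ∀ v, spaceDeriv v (spaceDeriv e₀ (spaceDeriv e₀ W)) (x₀, t₀) = 0 := fun v => by
        simpa using (hcond 0 v).1
      have hlow := dirDeriv_time_ge_of_touching hO hp ha_smooth ha hρ_smooth hρ_pos hρ_ode
        hb₁_smooth hb₁_convex hb₂_smooth hb₂_convex hb₃_smooth hb₃_convex hWdef hW hw_eq hz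
        (hw_pos _ hz.1 _ hz.2) he₀1 hnull hcrit fun c v => (hcond c v).2
      have hup : dirDeriv ((0 : EuclideanSpace ℝ (Fin n)), (1 : ℝ))
          (spaceDeriv e₀ (spaceDeriv e₀ W)) (x₀, t₀) + μ * K ≤ 0 := by
        have hd1 := deriv_time_eq_dirDeriv (z := (x₀, t₀))
          (w := fun x t => spaceDeriv e₀ (spaceDeriv e₀ W) (x, t)) hO
          ((hW.dirDeriv hU _).dirDeriv hU _) hz
        have hd2 : HasDerivAt (fun t => ε * Real.exp (K * t)) (μ * K) t₀ := by
          have := (((hasDerivAt_id t₀).const_mul K).exp).const_mul ε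
          simpa [hμ, mul_assoc] using this
        refine deriv_nonpos_of_nonneg_left (hd1.add hd2) ?_ ?_
        · simpa [he₀1] using hz0
        · filter_upwards [Ioo_mem_nhdsLT ht₀.1] with s hs
          have h1 := hnn s ⟨hs.1.le, hs.2.le⟩ x₀ hx₀ e₀ he₀
          rwa [hHW (x₀, s) ⟨hz.1, hs.1⟩] at h1
      have hb := hM (((x₀, t₀), e₀), μ) ⟨hyZ, hμpos.le, hμ1⟩
      simp only [Real.norm_eq_abs] at hb
      have h1 := neg_le_of_abs_le (hb.trans (le_abs_self M))
      have h2 : μ * (touchingRemainder p a ρ b₁ b₂ b₃ w (x₀, t₀) e₀ μ + K) ≤ 0 := by linarith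
      have h3 : 0 < μ * (touchingRemainder p a ρ b₁ b₂ b₃ w (x₀, t₀) e₀ μ + K) :=
        mul_pos hμpos (by linarith)
      linarith
    by_contra! hneg
    -- With `ε = κ exp(-K T)` the perturbation at time `T` equals `κ`: at most `1`, as `key`
    -- requires, and at most `-D²w(e,e)`, which contradicts strict positivity.
    set κ := min 1 (-spaceHess Ω w x T e e) with hκ
    have hκpos : 0 < κ := lt_min one_pos (by linarith)
    have hcancel : κ * Real.exp (-(K * T)) * Real.exp (K * T) = κ := by
      rw [mul_assoc, ← Real.exp_add]; simp
    have := key (κ * Real.exp (-(K * T))) (by positivity) (hcancel.trans_le (min_le_left _ _))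
      ((x, T), e) ⟨⟨subset_closure hx, hT, le_rfl⟩, by simpa [hS] using he⟩
    simp only [hcancel] at this
    linarith [min_le_right 1 (-spaceHess Ω w x T e e)]
  refine ⟨fun x hx t ht e he => hmain t ht x hx e he, fun t ht => ?_⟩
  refine convexOn_of_fderiv_fderiv_nonneg hO hΩ.convex
    ((hw_smooth.contDiffOn_slice t ht).mono subset_closure) fun x hx v => ?_
  rw [← spaceHess_eq_fderiv_fderiv hO hx]
  rcases eq_or_ne v 0 with rfl | hv
  · simp [spaceHess_eq_fderiv_fderiv hO hx]
  · have hvn : ‖v‖ ≠ 0 := norm_ne_zero_iff.2 hv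
    have h1 := hmain t ht x hx (‖v‖⁻¹ • v) (by simp [norm_smul, hvn])
    rw [spaceHess_smul_smul hud (subset_closure hx)] at h1
    exact nonneg_of_mul_nonneg_right h1 (by positivity)
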